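/- Let $K$ be a finite connected CW complex of dimension at most two, with fundamental group $\Pi=\pi_1(K,x_0)$ for a base point $x_0\in K$. Identify $\mathrm{Aut}(\mathbb{Z})$ with $\mathbb{Z}_2=\{1,-1\}$, so that each homomorphism $\alpha\in\hom(\Pi,\mathbb{Z}_2)$ is a local integer coefficient system over $K$, and let $H^2(K;{}_{\alpha}\mathbb{Z})$ denote the second (singular) cohomology group of $K$ with coefficients in this local system. If $H^2(K;{}_{\beta}\mathbb{Z})$ is finite of odd order for some $\beta\in\hom(\Pi,\mathbb{Z}_2)$, then $H^2(K;{}_{\alpha}\mathbb{Z})$ is finite of odd order for every $\alpha\in\hom(\Pi,\mathbb{Z}_2)$. -/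

import Mathlib

open Topology

noncomputable section

namespace LocalCoeff

/-- The standard topological `n`-simplex. -/
abbrev Simplex (n : ℕ) : Type := stdSimplex ℝ (Fin (n + 1))

/-- The leading vertex `e₀` of the standard `n`-simplex. -/
abbrev e₀ (n : ℕ) : Simplex n := stdSimplex.vertex 0

/-- The affine map of standard simplices given by a map of their vertices. -/
def simplexMap {m n : ℕ} (f : Fin (m + 1) → Fin (n + 1)) : C(Simplex m, Simplex n) :=
  ⟨stdSimplex.map f, stdSimplex.continuous_map f⟩

/-- The straight path between two points of a standard simplex. -/
def segmentPath {n : ℕ} (v w : Simplex n) : Path v w where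
  toFun t := ⟨AffineMap.lineMap (v : Fin (n + 1) → ℝ) w (t : ℝ),
    (convex_stdSimplex ℝ (Fin (n + 1))).lineMap_mem v.2 w.2 t.2⟩
  continuous_toFun := by
    refine Continuous.subtype_mk ?_ _
    simp only [AffineMap.lineMap_apply]
    fun_prop
  source' := Subtype.ext (AffineMap.lineMap_apply_zero _ _)
  target' := Subtype.ext (AffineMap.lineMap_apply_one _ _)

variable {X : Type*} [TopologicalSpace X] {x₀ : X}

/-- The fibre over `x` of the local system of infinite cyclic groups on `X` associated with
`α : π₁(X, x₀) → {1, -1} = Aut ℤ`: the functions `f` on the homotopy classes of paths from `x₀`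
to `x` (that is, on the fibre over `x` of the universal covering) with values in `ℤ` that are
equivariant, `f (g · γ) = α g * f γ`. If `x` can be joined to `x₀`, evaluation at any `γ`
identifies the fibre with `ℤ`. -/
def fibre (α : FundamentalGroup X x₀ →* ℤˣ) (x : X) :
    Submodule ℤ (Path.Homotopic.Quotient x₀ x → ℤ) where
  carrier := {f | ∀ (g : FundamentalGroup X x₀) (γ : Path.Homotopic.Quotient x₀ x),
    f (g.toPath.trans γ) = (α g : ℤ) * f γ}
  add_mem' hf hg a γ := by simp [hf a γ, hg a γ, mul_add]
  zero_mem' _ _ := by simp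
  smul_mem' c f hf a γ := by simp [hf a γ, mul_left_comm]

/-- The parallel transport of the local system along (the inverse of) a path class
`δ` from `x` to `y`, as a map from the fibre over `y` to the fibre over `x`. -/
def transport (α : FundamentalGroup X x₀ →* ℤˣ) {x y : X} (δ : Path.Homotopic.Quotient x y) :
    fibre α y →ₗ[ℤ] fibre α x where
  toFun f := ⟨fun γ => f.1 (γ.trans δ), fun g γ =>
    (congrArg f.1 (Path.Homotopic.Quotient.trans_assoc g.toPath γ δ)).trans (f.2 g _)⟩
  map_add' _ _ := rfl
  map_smul' _ _ := rfl

/-- Singular `n`-cochains of `X` with coefficients in the local system of `α`: a cochain assigns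
to a singular simplex `σ` an element of the fibre over its leading vertex `σ e₀`. -/
abbrev Cochain (α : FundamentalGroup X x₀ →* ℤˣ) (n : ℕ) : Type _ :=
  (σ : C(Simplex n, X)) → fibre α (σ (e₀ n))

/-- The map of cochains induced by a map of vertices: `φ` is evaluated on `σ ∘ f`, and the value,
which lies in the fibre over `σ (f e₀)`, is transported to the fibre over `σ e₀` along the image
under `σ` of the straight path from `e₀` to `f e₀`. -/
def pull (α : FundamentalGroup X x₀ →* ℤˣ) {m n : ℕ} (f : Fin (m + 1) → Fin (n + 1)) :
    Cochain α m →ₗ[ℤ] Cochain α n :=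
  LinearMap.pi fun σ =>
    (transport α (x := σ (e₀ n)) (y := (σ.comp (simplexMap f)) (e₀ m))
        ((Path.Homotopic.Quotient.mk (segmentPath (e₀ n) (simplexMap f (e₀ m)))).map σ)).comp
      (LinearMap.proj (σ.comp (simplexMap f)))

/-- The coboundary `δ = ∑ᵢ (-1)ⁱ dᵢ` of the singular cochain complex with local coefficients. -/
def coboundary (α : FundamentalGroup X x₀ →* ℤˣ) (n : ℕ) :
    Cochain α n →ₗ[ℤ] Cochain α (n + 1) :=
  ∑ i : Fin (n + 2), (-1 : ℤ) ^ (i : ℕ) • pull α i.succAbove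

theorem apply_eq_of_heq {α : FundamentalGroup X x₀ →* ℤˣ} {n : ℕ} (φ : Cochain α n)
    {σ τ : C(Simplex n, X)} (h : σ = τ) {γ : Path.Homotopic.Quotient x₀ (σ (e₀ n))}
    {γ' : Path.Homotopic.Quotient x₀ (τ (e₀ n))} (hγ : HEq γ γ') :
    (φ σ).1 γ = (φ τ).1 γ' := by
  subst h; rw [eq_of_heq hγ]

instance (n : ℕ) : ContractibleSpace (Simplex n) :=
  (convex_stdSimplex ℝ (Fin (n + 1))).contractibleSpace ⟨_, (e₀ n).2⟩

theorem pull_comp (α : FundamentalGroup X x₀ →* ℤˣ) {l m n : ℕ}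
    (f : Fin (m + 1) → Fin (n + 1)) (g : Fin (l + 1) → Fin (m + 1)) :
    (pull α f).comp (pull α g) = pull α (f ∘ g) := by
  ext φ σ γ
  have hfg (v : Simplex l) : simplexMap (f ∘ g) v = simplexMap f (simplexMap g v) :=
    (stdSimplex.map_comp_apply g f v).symm
  have key {w w' : Simplex n} (hw : w = w') (P : Path.Homotopic.Quotient (e₀ n) w)
      (Q : Path.Homotopic.Quotient (e₀ n) w') : HEq (γ.trans (P.map σ)) (γ.trans (Q.map σ)) := by
    subst hw; rw [Subsingleton.elim P Q]
  refine apply_eq_of_heq φ (ContinuousMap.ext fun v => congrArg σ (hfg v).symm) ?_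
  refine HEq.trans (heq_of_eq ?_) (key (hfg (e₀ l)).symm
    ((Path.Homotopic.Quotient.mk (segmentPath (e₀ n) (simplexMap f (e₀ m)))).trans
      ((Path.Homotopic.Quotient.mk (segmentPath (e₀ m) (simplexMap g (e₀ l)))).map
        (simplexMap f))) _)
  rw [Path.Homotopic.Quotient.trans_assoc]
  congr 1
  simp only [← Path.Homotopic.Quotient.mk_map, ← Path.Homotopic.Quotient.mk_trans]
  rw [Path.map_trans]
  rfl

/-- The square of the coboundary is zero. -/
theorem coboundary_comp_coboundary (α : FundamentalGroup X x₀ →* ℤˣ) (n : ℕ) :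
    (coboundary α (n + 1)).comp (coboundary α n) = 0 := by
  ext1 φ
  have pull_pull (i : Fin (n + 3)) (j : Fin (n + 2)) :
      pull α i.succAbove (pull α j.succAbove φ) = pull α (i.succAbove ∘ j.succAbove) φ :=
    LinearMap.congr_fun (pull_comp α _ _) φ
  simp only [coboundary, LinearMap.comp_apply, LinearMap.sum_apply, LinearMap.smul_apply, map_sum,
    map_smul, Finset.smul_sum, smul_smul, ← pow_add, pull_pull, LinearMap.zero_apply]
  rw [Finset.sum_comm, ← Finset.sum_product', Finset.univ_product_univ]
  have face_face (i : Fin (n + 3)) (j : Fin (n + 2)) (h : (j : ℕ) < i) :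
      i.succAbove ∘ j.succAbove =
        j.castSucc.succAbove ∘ (i.pred (by rintro rfl; simp at h)).succAbove := by
    ext k
    simp only [Function.comp, Fin.succAbove, Fin.lt_def]
    grind
  refine Finset.sum_involution (fun (p : Fin (n + 3) × Fin (n + 2)) _ =>
    if h : (p.2 : ℕ) < p.1 then
      (p.2.castSucc, p.1.pred (by intro h0; simp [h0] at h))
    else (p.2.succ, p.1.castLT (by omega))) ?_ ?_ ?_ ?_
  · rintro ⟨i, j⟩ -
    by_cases h : (j : ℕ) < i
    · simp only [h, dite_true, face_face i j h]
      rw [← add_smul]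
      convert zero_smul ℤ _
      obtain ⟨k, rfl⟩ := Fin.eq_succ_of_ne_zero (show i ≠ 0 by rintro rfl; simp at h)
      simp; ring
    · have h' : ((i.castLT (by omega) : Fin (n + 2)) : ℕ) < j.succ := by simp; omega
      simp only [h, dite_false, face_face _ _ h']
      simp only [Fin.castSucc_castLT, Fin.pred_succ]
      rw [← add_smul]
      convert zero_smul ℤ _
      simp; ring
  · rintro ⟨i, j⟩ - - he
    split_ifs at he with h
    · have := congrArg (fun p => (p.1 : ℕ)) he
      simp at this h; omega
    · have := congrArg (fun p => (p.1 : ℕ)) he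
      simp at this h; omega
  · simp
  · rintro ⟨i, j⟩ -
    by_cases h : (j : ℕ) < i
    · have : ¬ ((i : ℕ) - 1 < j) := by omega
      simp [h, this]
    · have : (i : ℕ) < j + 1 := by omega
      simp [h, this]

/-- The group of `n`-coboundaries. -/
def boundaries (α : FundamentalGroup X x₀ →* ℤˣ) : (n : ℕ) → Submodule ℤ (Cochain α n)
  | 0 => ⊥
  | n + 1 => LinearMap.range (coboundary α n)

/-- The `n`-th (singular) cohomology group `Hⁿ(X; _αℤ)` of `X` with coefficients in the local
system of `α : π₁(X, x₀) → {1, -1} = Aut ℤ`: cocycles modulo coboundaries. -/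
abbrev Cohomology (α : FundamentalGroup X x₀ →* ℤˣ) (n : ℕ) : Type _ :=
  LinearMap.ker (coboundary α n) ⧸ (boundaries α n).submoduleOf (LinearMap.ker (coboundary α n))

end LocalCoeff

end

/-!
The coboundaries of two local systems agree modulo two, and `H^(d+1)` vanishes for all of them on a
complex of dimension `d`, so multiplication by two is surjective on `H^d` for one system if and only
if it is for every other: this is the comparison of both with `H^d(K; ℤ/2)` in the coefficient
sequence of `2 : ℤ → ℤ`. A finitely generated abelian group on which multiplication by two is
surjective is finite of odd order, and conversely.

Finite generation and vanishing above the dimension are proved one cell at a time by the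
Mayer-Vietoris sequence of the cover by the punctured complex and the open cell. Their overlap, a
punctured ball, is covered by the convex pieces on which some coordinate is positive or negative,
and the intersections of these are convex or empty, so no cohomology of spheres is needed.
-/

noncomputable section

namespace TwistedSingular

open LocalCoeff (Simplex simplexMap segmentPath e₀)

/-! ### Chains of ordered tuples -/

theorem hom_ext_single {ι R M : Type*} [Semiring R] [AddCommMonoid M] [Module R M]
    {f g : (ι →₀ R) →ₗ[R] M}
    (h : ∀ i, f (Finsupp.single i 1) = g (Finsupp.single i 1)) : f = g :=
  Finsupp.lhom_ext' fun i => LinearMap.ext_ring (h i)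

/-- Integral chains of ordered `k`-tuples of points of `Y`. They form the augmented simplicial chain
complex of the full simplex on `Y`, a `k`-tuple having dimension `k - 1`. -/
abbrev TupleChain (Y : Type*) (k : ℕ) : Type _ := (Fin k → Y) →₀ ℤ

namespace TupleChain

variable {Y Y' Z Z' : Type*} {k : ℕ}

/-- The generator given by a tuple. -/
abbrev of (v : Fin k → Y) : TupleChain Y k := Finsupp.single v 1

/-- The boundary, omitting the entries of a tuple one at a time. -/
def bd (k : ℕ) : TupleChain Y (k + 1) →ₗ[ℤ] TupleChain Y k :=
  Finsupp.linearCombination ℤ fun v => ∑ i : Fin (k + 1), (-1 : ℤ) ^ (i : ℕ) • of (v ∘ i.succAbove)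

/-- The cone with apex `b`. -/
def cone (b : Y) (k : ℕ) : TupleChain Y k →ₗ[ℤ] TupleChain Y (k + 1) :=
  Finsupp.lmapDomain ℤ ℤ fun v => (Fin.cons b v : Fin (k + 1) → Y)

/-- The chain map induced by a map of points. -/
def map (f : Y → Y') (k : ℕ) : TupleChain Y k →ₗ[ℤ] TupleChain Y' k :=
  Finsupp.lmapDomain ℤ ℤ (f ∘ ·)

theorem bd_of (v : Fin (k + 1) → Y) :
    bd k (of v) = ∑ i : Fin (k + 1), (-1 : ℤ) ^ (i : ℕ) • of (v ∘ i.succAbove) := by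
  simp [bd]

@[simp] theorem cone_of (b : Y) (v : Fin k → Y) : cone b k (of v) = of (Fin.cons b v) := by
  simp [cone]

@[simp] theorem map_of (f : Y → Y') (v : Fin k → Y) : map f k (of v) = of (f ∘ v) := by
  simp [map]

theorem bd_map (f : Y → Y') (c : TupleChain Y (k + 1)) :
    bd k (map f (k + 1) c) = map f k (bd k c) := by
  suffices h : bd k ∘ₗ map f (k + 1) = map f k ∘ₗ bd k from LinearMap.congr_fun h c
  refine hom_ext_single fun v => ?_
  simp only [LinearMap.comp_apply, map_of, bd_of, map_sum, map_smul, Function.comp_assoc]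

theorem map_cone (f : Y → Y') (b : Y) (c : TupleChain Y k) :
    map f (k + 1) (cone b k c) = cone (f b) k (map f k c) := by
  suffices h : map f (k + 1) ∘ₗ cone b k = cone (f b) k ∘ₗ map f k from LinearMap.congr_fun h c
  refine hom_ext_single fun v => ?_
  simp only [LinearMap.comp_apply, map_of, cone_of, Fin.comp_cons]

theorem bd_cone (b : Y) (c : TupleChain Y (k + 1)) :
    bd (k + 1) (cone b (k + 1) c) = c - cone b k (bd k c) := by
  suffices h : bd (k + 1) ∘ₗ cone b (k + 1) = LinearMap.id - cone b k ∘ₗ bd k from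
    LinearMap.congr_fun h c
  refine hom_ext_single fun v => ?_
  have h0 : (Fin.cons b v : Fin (k + 2) → Y) ∘ Fin.succAbove 0 = v := by ext i; simp
  have hs (i : Fin (k + 1)) : (Fin.cons b v : Fin (k + 2) → Y) ∘ i.succ.succAbove =
      Fin.cons b (v ∘ i.succAbove) := by
    ext j
    refine Fin.cases ?_ (fun j => ?_) j <;> simp
  simp only [LinearMap.comp_apply, LinearMap.sub_apply, LinearMap.id_apply, cone_of, bd_of,
    map_sum, map_smul, Fin.sum_univ_succ (n := k + 1), h0, hs]
  simp [pow_succ, sub_eq_add_neg]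

theorem bd_cone_zero (b : Y) (c : TupleChain Y 0) : bd 0 (cone b 0 c) = c := by
  suffices h : bd 0 ∘ₗ cone b 0 = LinearMap.id from LinearMap.congr_fun h c
  refine hom_ext_single fun v => ?_
  simp [bd_of, Subsingleton.elim _ v]

theorem of_eq_cone (v : Fin (k + 1) → Y) : of v = cone (v 0) k (of (Fin.tail v)) := by
  rw [cone_of, Fin.cons_self_tail]

theorem bd_bd (c : TupleChain Y (k + 2)) : bd k (bd (k + 1) c) = 0 := by
  suffices h : bd k ∘ₗ bd (k + 1) = (0 : TupleChain Y (k + 2) →ₗ[ℤ] TupleChain Y k) from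
    LinearMap.congr_fun h c
  clear c
  induction k with
  | zero =>
    refine hom_ext_single fun v => ?_
    change bd 0 (bd 1 (of v)) = 0
    rw [of_eq_cone, bd_cone, map_sub, bd_cone_zero, sub_self]
  | succ k ih =>
    refine hom_ext_single fun v => ?_
    have bd_bd_tail : bd k (bd (k + 1) (of (Fin.tail v))) = 0 := LinearMap.congr_fun ih _
    change bd (k + 1) (bd (k + 2) (of v)) = 0
    rw [of_eq_cone, bd_cone, map_sub, bd_cone, bd_bd_tail, map_zero, sub_zero, sub_self]

/-- A chain homotopy from `f` to `g`, where the value on a tuple `v` is the cone with apex `a k v`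
on the cycle that has to be bounded. -/
def coneHomotopy (a : ∀ k, (Fin (k + 1) → Y) → Z) (f g : ∀ k, TupleChain Y k →ₗ[ℤ] TupleChain Z k) :
    ∀ k, TupleChain Y k →ₗ[ℤ] TupleChain Z (k + 1)
  | 0 => 0
  | k + 1 => Finsupp.linearCombination ℤ fun v => cone (a k v) (k + 1)
      (g (k + 1) (of v) - f (k + 1) (of v) - coneHomotopy a f g k (bd k (of v)))

section ConeHomotopy

variable {a : ∀ k, (Fin (k + 1) → Y) → Z} {a' : ∀ k, (Fin (k + 1) → Y') → Z'}
  {f g : ∀ k, TupleChain Y k →ₗ[ℤ] TupleChain Z k}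
  {f' g' : ∀ k, TupleChain Y' k →ₗ[ℤ] TupleChain Z' k}

@[simp] theorem coneHomotopy_zero : coneHomotopy a f g 0 = 0 := rfl

theorem coneHomotopy_succ_of (v : Fin (k + 1) → Y) :
    coneHomotopy a f g (k + 1) (of v) = cone (a k v) (k + 1)
      (g (k + 1) (of v) - f (k + 1) (of v) - coneHomotopy a f g k (bd k (of v))) := by
  simp [coneHomotopy]

theorem bd_coneHomotopy (hf : ∀ k c, bd k (f (k + 1) c) = f k (bd k c))
    (hg : ∀ k c, bd k (g (k + 1) c) = g k (bd k c)) (h0 : f 0 = g 0) (c : TupleChain Y (k + 1)) :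
    bd (k + 1) (coneHomotopy a f g (k + 1) c) =
      g (k + 1) c - f (k + 1) c - coneHomotopy a f g k (bd k c) := by
  revert c
  suffices h : bd (k + 1) ∘ₗ coneHomotopy a f g (k + 1) =
      g (k + 1) - f (k + 1) - coneHomotopy a f g k ∘ₗ bd k from LinearMap.congr_fun h
  induction k with
  | zero =>
    refine hom_ext_single fun v => ?_
    simp [coneHomotopy_succ_of, bd_cone, hf, hg, h0]
  | succ k ih =>
    refine hom_ext_single fun v => ?_
    have bd_homotopy_bd := LinearMap.congr_fun ih (bd (k + 1) (of v))
    simp only [LinearMap.comp_apply, LinearMap.sub_apply, bd_bd, map_zero, sub_zero]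
      at bd_homotopy_bd ⊢
    rw [coneHomotopy_succ_of, bd_cone]
    simp only [map_sub, hf, hg, bd_homotopy_bd, sub_self, map_zero, sub_zero]

theorem map_coneHomotopy {p : Y → Y'} {q : Z → Z'} (ha : ∀ k v, q (a k v) = a' k (p ∘ v))
    (hf : ∀ k c, map q k (f k c) = f' k (map p k c))
    (hg : ∀ k c, map q k (g k c) = g' k (map p k c)) (c : TupleChain Y k) :
    map q (k + 1) (coneHomotopy a f g k c) = coneHomotopy a' f' g' k (map p k c) := by
  revert c
  suffices h : map q (k + 1) ∘ₗ coneHomotopy a f g k = coneHomotopy a' f' g' k ∘ₗ map p k from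
    LinearMap.congr_fun h
  induction k with
  | zero => simp
  | succ k ih =>
    refine hom_ext_single fun v => ?_
    have map_homotopy_bd := LinearMap.congr_fun ih (bd k (of v))
    simp only [LinearMap.comp_apply] at map_homotopy_bd ⊢
    rw [map_of, coneHomotopy_succ_of, coneHomotopy_succ_of, map_cone, ha, (map q _).map_sub,
      (map q _).map_sub, hf, hg, map_homotopy_bd, ← bd_map, map_of]

end ConeHomotopy

/-- Subdivision of tuples with respect to a choice of centres. -/
def sd (β : ∀ k, (Fin (k + 1) → Y) → Y) : ∀ k, TupleChain Y k →ₗ[ℤ] TupleChain Y k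
  | 0 => LinearMap.id
  | k + 1 => Finsupp.linearCombination ℤ fun v => cone (β k v) k (sd β k (bd k (of v)))

/-- The chain homotopy from the subdivision to the identity. -/
def sdHomotopy (β : ∀ k, (Fin (k + 1) → Y) → Y) : ∀ k, TupleChain Y k →ₗ[ℤ] TupleChain Y (k + 1) :=
  coneHomotopy β (sd β) fun _ => LinearMap.id

section Subdivision

variable {β : ∀ k, (Fin (k + 1) → Y) → Y} {β' : ∀ k, (Fin (k + 1) → Y') → Y'}

theorem sd_succ_of (v : Fin (k + 1) → Y) :
    sd β (k + 1) (of v) = cone (β k v) k (sd β k (bd k (of v))) := by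
  simp [sd]

theorem bd_sd (c : TupleChain Y (k + 1)) : bd k (sd β (k + 1) c) = sd β k (bd k c) := by
  revert c
  suffices h : bd k ∘ₗ sd β (k + 1) = sd β k ∘ₗ bd k from LinearMap.congr_fun h
  induction k with
  | zero =>
    refine hom_ext_single fun v => ?_
    simp only [LinearMap.comp_apply, sd_succ_of, bd_cone_zero]
  | succ k ih =>
    refine hom_ext_single fun v => ?_
    have bd_sd_bd := LinearMap.congr_fun ih (bd (k + 1) (of v))
    simp only [LinearMap.comp_apply] at bd_sd_bd ⊢
    simp only [sd_succ_of, bd_cone, bd_sd_bd, bd_bd, map_zero, sub_zero]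

theorem bd_sdHomotopy (c : TupleChain Y (k + 1)) :
    bd (k + 1) (sdHomotopy β (k + 1) c) = c - sd β (k + 1) c - sdHomotopy β k (bd k c) :=
  bd_coneHomotopy (f := sd β) (g := fun _ => LinearMap.id) (fun _ => bd_sd) (fun _ _ => rfl) rfl c

theorem map_sd {f : Y → Y'} (hf : ∀ k v, f (β k v) = β' k (f ∘ v)) (c : TupleChain Y k) :
    map f k (sd β k c) = sd β' k (map f k c) := by
  revert c
  suffices h : map f k ∘ₗ sd β k = sd β' k ∘ₗ map f k from LinearMap.congr_fun h
  induction k with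
  | zero => rfl
  | succ k ih =>
    refine hom_ext_single fun v => ?_
    have map_sd_bd := LinearMap.congr_fun ih (bd k (of v))
    simp only [LinearMap.comp_apply] at map_sd_bd ⊢
    simp only [map_of, sd_succ_of, map_cone, map_sd_bd, hf, ← bd_map]

theorem map_sdHomotopy {f : Y → Y'} (hf : ∀ k v, f (β k v) = β' k (f ∘ v)) (c : TupleChain Y k) :
    map f (k + 1) (sdHomotopy β k c) = sdHomotopy β' k (map f k c) :=
  map_coneHomotopy hf (fun _ => map_sd hf) (fun _ _ => rfl) c

end Subdivision

/-- The prism operator: the chain homotopy between the inclusions of `Y` as `Y × {a}` and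
`Y × {b}`. -/
def prism {I : Type*} (a b : I) : ∀ k, TupleChain Y k →ₗ[ℤ] TupleChain (Y × I) (k + 1) :=
  coneHomotopy (fun _ v => (v 0, a)) (map (·, a)) (map (·, b))

theorem bd_prism {I : Type*} (a b : I) (c : TupleChain Y (k + 1)) :
    bd (k + 1) (prism a b (k + 1) c) =
      map (·, b) (k + 1) c - map (·, a) (k + 1) c - prism a b k (bd k c) :=
  bd_coneHomotopy (fun _ => bd_map _) (fun _ => bd_map _)
    (by unfold map; congr 1; exact funext fun _ => Subsingleton.elim _ _) c

theorem map_prism {I : Type*} (a b : I) (f : Y → Y') (c : TupleChain Y k) :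
    map (Prod.map f id) (k + 1) (prism a b k c) = prism a b k (map f k c) := by
  have map_slice (x : I) (k : ℕ) (c : TupleChain Y k) :
      map (Prod.map f id) k (map (·, x) k c) = map (·, x) k (map f k c) := by
    simp only [map, Finsupp.lmapDomain_apply, ← Finsupp.mapDomain_comp]
    rfl
  exact map_coneHomotopy (fun _ _ => rfl) (map_slice a) (map_slice b) c

end TupleChain

/-! ### Affine simplices -/

/-- The vertices of the standard simplex. -/
abbrev vert {n : ℕ} (i : Fin (n + 1)) : Simplex n := stdSimplex.vertex i

section Convex

variable {E : Type*} [AddCommGroup E] [Module ℝ E] [TopologicalSpace E]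
    [IsTopologicalAddGroup E] [ContinuousSMul ℝ E] {Y : Set E}

/-- The affine simplex in a convex set spanned by a tuple of points. -/
def convexLin (hY : Convex ℝ Y) {m : ℕ}
    (v : Fin (m + 1) → Y) : C(Simplex m, Y) where
  toFun t := ⟨∑ i, t.1 i • (v i : E),
    hY.sum_mem (fun i _ => t.2.1 i) t.2.2 fun i _ => (v i).2⟩
  continuous_toFun := by
    refine Continuous.subtype_mk (continuous_finsetSum _ fun i _ => ?_) _
    exact ((continuous_apply i).comp continuous_subtype_val).smul continuous_const

theorem convexLin_coe (hY : Convex ℝ Y) {m : ℕ} (v : Fin (m + 1) → Y) (t : Simplex m) :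
    (convexLin hY v t : E) = ∑ i, t.1 i • (v i : E) := rfl

end Convex

/-- The affine map of standard simplices with given values at the vertices. -/
def simplexLin {m k : ℕ} (v : Fin (m + 1) → Simplex k) : C(Simplex m, Simplex k) :=
  convexLin (convex_stdSimplex ℝ (Fin (k + 1))) v

/-- A space in which tuples of points span affine simplices. -/
class AffineSimplices (Y : Type*) [TopologicalSpace Y] where
  /-- The affine simplex spanned by a tuple. -/
  lin {m : ℕ} (v : Fin (m + 1) → Y) : C(Simplex m, Y)
  lin_vert {m : ℕ} (v : Fin (m + 1) → Y) (i : Fin (m + 1)) : lin v (vert i) = v i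
  lin_lin {m k : ℕ} (v : Fin (m + 1) → Y) (u : Fin (k + 1) → Simplex m) :
    (lin v).comp (simplexLin u) = lin (lin v ∘ u)

open AffineSimplices (lin lin_vert lin_lin)

/-- Convex sets contain the affine simplices spanned by their tuples. -/
@[reducible] def AffineSimplices.ofConvex {E : Type*} [AddCommGroup E] [Module ℝ E]
    [TopologicalSpace E] [IsTopologicalAddGroup E] [ContinuousSMul ℝ E] {Y : Set E}
    (hY : Convex ℝ Y) : AffineSimplices Y where
  lin := convexLin hY
  lin_vert v i := by
    apply Subtype.ext
    rw [convexLin_coe]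
    simp [Pi.single_apply]
  lin_lin v u := by
    refine ContinuousMap.ext fun t => Subtype.ext ?_
    simp only [ContinuousMap.comp_apply, convexLin_coe, simplexLin, Function.comp_apply,
      Finset.smul_sum, Finset.sum_apply, Finset.sum_smul, Pi.smul_apply, smul_eq_mul, smul_smul]
    rw [Finset.sum_comm]

instance (n : ℕ) : AffineSimplices (Simplex n) :=
  AffineSimplices.ofConvex (convex_stdSimplex ℝ (Fin (n + 1)))

instance : AffineSimplices unitInterval :=
  AffineSimplices.ofConvex (convex_Icc (0 : ℝ) 1)

instance {Y Z : Type*} [TopologicalSpace Y] [TopologicalSpace Z] [AffineSimplices Y]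
    [AffineSimplices Z] : AffineSimplices (Y × Z) where
  lin v := (lin (Prod.fst ∘ v)).prodMk (lin (Prod.snd ∘ v))
  lin_vert v i := by simp [lin_vert]
  lin_lin v u := by
    ext t
    · exact DFunLike.congr_fun (lin_lin (Prod.fst ∘ v) u) t
    · exact DFunLike.congr_fun (lin_lin (Prod.snd ∘ v) u) t

theorem lin_simplex_coe {m n : ℕ} (v : Fin (m + 1) → Simplex n) (t : Simplex m) :
    (lin v t).1 = ∑ i, t.1 i • (v i).1 := rfl

theorem lin_vert_eq_id (n : ℕ) : lin (fun i : Fin (n + 1) => vert i) = ContinuousMap.id _ := by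
  refine ContinuousMap.ext fun t => Subtype.ext ?_
  rw [lin_simplex_coe]
  funext j
  simp [Pi.single_apply, Finset.sum_apply]

theorem lin_vert_comp {m n : ℕ} (f : Fin (m + 1) → Fin (n + 1)) :
    lin (fun i => vert (f i)) = simplexMap f := by
  refine ContinuousMap.ext fun t => Subtype.ext ?_
  rw [lin_simplex_coe]
  change _ = (stdSimplex.map f t).1
  rw [show (stdSimplex.map f t).1 = _ from stdSimplex.map_coe f t]
  funext j
  simp [Pi.single_apply, Finset.sum_apply, FunOnFinite.linearMap_apply_apply, Finset.sum_ite,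
    eq_comm (a := j)]
  rfl

variable {X : Type*} [TopologicalSpace X]

section Affine

variable {Y : Type*} [TopologicalSpace Y] [AffineSimplices Y]

theorem lin_comp_simplexMap {m n : ℕ} (v : Fin (n + 1) → Y) (f : Fin (m + 1) → Fin (n + 1)) :
    (lin v).comp (simplexMap f) = lin (v ∘ f) := by
  rw [← lin_vert_comp]
  refine (lin_lin v fun i => vert (f i)).trans ?_
  congr 1
  ext i
  simp [lin_vert]

/-- The barycentre of a tuple of points. -/
def bary (m : ℕ) (v : Fin (m + 1) → Y) : Y := lin v stdSimplex.barycenter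

theorem lin_bary {m : ℕ} (v : Fin (m + 1) → Y) (k : ℕ) (u : Fin (k + 1) → Simplex m) :
    lin v (bary k u) = bary k (lin v ∘ u) :=
  DFunLike.congr_fun (lin_lin v u) stdSimplex.barycenter

/-! ### Twisted singular chains -/

/-- A multiplicative singular `1`-cocycle with values in `{1, -1}`: a local system of infinite
cyclic groups with a generator chosen at each point. -/
structure Twist (X : Type*) [TopologicalSpace X] where
  /-- The sign of the transport along a path. -/
  sign : C(Simplex 1, X) → ℤˣ
  cocycle (σ : C(Simplex 2, X)) :
    sign (σ.comp (simplexMap ![0, 1])) * sign (σ.comp (simplexMap ![1, 2])) =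
      sign (σ.comp (simplexMap ![0, 2]))

namespace Twist

variable (w : Twist X)

/-- The sign of the image under `G` of the segment from `y` to `z`. -/
def seg (G : C(Y, X)) (y z : Y) : ℤˣ := w.sign (G.comp (lin ![y, z]))

theorem seg_mul_seg (G : C(Y, X)) (x y z : Y) : w.seg G x y * w.seg G y z = w.seg G x z := by
  have := w.cocycle (G.comp (lin ![x, y, z]))
  simp only [ContinuousMap.comp_assoc, lin_comp_simplexMap] at this
  convert this using 2 <;> simp only [seg] <;> congr 3 <;> ext i <;> fin_cases i <;> rfl

@[simp] theorem seg_self (G : C(Y, X)) (y : Y) : w.seg G y y = 1 :=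
  mul_eq_left.1 (w.seg_mul_seg G y y y)

theorem seg_comp_lin (G : C(Y, X)) {n : ℕ} (v : Fin (n + 1) → Y) (s t : Simplex n) :
    w.seg (G.comp (lin v)) s t = w.seg G (lin v s) (lin v t) := by
  simp only [seg, ContinuousMap.comp_assoc]
  congr 2
  refine (lin_lin v ![s, t]).trans ?_
  congr 1
  ext i; fin_cases i <;> rfl

end Twist

/-- Integral singular chains. -/
abbrev Chain (X : Type*) [TopologicalSpace X] (n : ℕ) : Type _ := C(Simplex n, X) →₀ ℤ

/-- The generator given by a singular simplex. -/
abbrev Chain.of {n : ℕ} (σ : C(Simplex n, X)) : Chain X n := Finsupp.single σ 1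

/-- The boundary of singular chains twisted by `w`. -/
def bd (w : Twist X) (n : ℕ) : Chain X (n + 1) →ₗ[ℤ] Chain X n :=
  Finsupp.linearCombination ℤ fun σ => ∑ i : Fin (n + 2),
    ((-1 : ℤ) ^ (i : ℕ) * (w.seg σ (vert 0) (vert (i.succAbove 0)) : ℤˣ)) •
      Chain.of (σ.comp (simplexMap i.succAbove))

/-- The map from chains of tuples in `Y` to twisted singular chains induced by `G : Y → X` and
the trivialisation of the pulled back local system along segments from `y₀`. -/
def push (w : Twist X) (G : C(Y, X)) (y₀ : Y) (n : ℕ) : TupleChain Y (n + 1) →ₗ[ℤ] Chain X n :=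
  Finsupp.linearCombination ℤ fun v => (w.seg G y₀ (v 0) : ℤ) • Chain.of (G.comp (lin v))

variable (w : Twist X) {n : ℕ}

theorem bd_of (σ : C(Simplex (n + 1), X)) : bd w n (Chain.of σ) = ∑ i : Fin (n + 2),
    ((-1 : ℤ) ^ (i : ℕ) * (w.seg σ (vert 0) (vert (i.succAbove 0)) : ℤˣ)) •
      Chain.of (σ.comp (simplexMap i.succAbove)) := by
  simp [bd]

theorem push_of (G : C(Y, X)) (y₀ : Y) (v : Fin (n + 1) → Y) :
    push w G y₀ n (TupleChain.of v) =
      (w.seg G y₀ (v 0) : ℤ) • Chain.of (G.comp (lin v)) := by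
  simp [push]

theorem bd_push (G : C(Y, X)) (y₀ : Y) (c : TupleChain Y (n + 2)) :
    bd w n (push w G y₀ (n + 1) c) = push w G y₀ n (TupleChain.bd (n + 1) c) := by
  revert c
  suffices h : bd w n ∘ₗ push w G y₀ (n + 1) = push w G y₀ n ∘ₗ TupleChain.bd (n + 1) from
    LinearMap.congr_fun h
  refine hom_ext_single fun v => ?_
  simp only [LinearMap.comp_apply, push_of, map_smul, bd_of, TupleChain.bd_of, map_sum,
    Finset.smul_sum, smul_smul, w.seg_comp_lin, lin_vert, ContinuousMap.comp_assoc,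
    lin_comp_simplexMap, Function.comp_apply]
  refine Finset.sum_congr rfl fun i _ => ?_
  rw [← w.seg_mul_seg G y₀ (v 0) (v (i.succAbove 0))]
  push_cast
  congr 1
  ring

/-- The tautological simplex of a standard simplex. -/
abbrev taut (n : ℕ) : TupleChain (Simplex n) (n + 1) := TupleChain.of fun i => vert i

theorem push_taut (σ : C(Simplex n, X)) : push w σ (vert 0) n (taut n) = Chain.of σ := by
  rw [push_of, w.seg_self, lin_vert_eq_id]
  simp

theorem bd_eq_push (σ : C(Simplex (n + 1), X)) :
    bd w n (Chain.of σ) = push w σ (vert 0) n (TupleChain.bd (n + 1) (taut (n + 1))) := by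
  rw [← bd_push, push_taut]

theorem bd_bd (c : Chain X (n + 2)) : bd w n (bd w (n + 1) c) = 0 := by
  revert c
  suffices h : bd w n ∘ₗ bd w (n + 1) = 0 from LinearMap.congr_fun h
  refine hom_ext_single fun σ => ?_
  simp [bd_eq_push, bd_push, TupleChain.bd_bd]

theorem push_comp {Z : Type*} [TopologicalSpace Z] [AffineSimplices Z] (G : C(Y, X)) (y₀ : Y)
    (H : C(Z, Y)) (hH : ∀ {m : ℕ} (u : Fin (m + 1) → Z), H.comp (lin u) = lin (H ∘ u)) (z₀ : Z)
    (c : TupleChain Z (n + 1)) :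
    (w.seg G y₀ (H z₀) : ℤ) • push w (G.comp H) z₀ n c =
      push w G y₀ n (TupleChain.map H (n + 1) c) := by
  suffices h : (w.seg G y₀ (H z₀) : ℤ) • push w (G.comp H) z₀ n =
      push w G y₀ n ∘ₗ TupleChain.map H (n + 1) from LinearMap.congr_fun h c
  refine hom_ext_single fun u => ?_
  have hseg : w.seg (G.comp H) z₀ (u 0) = w.seg G (H z₀) (H (u 0)) := by
    simp only [Twist.seg, ContinuousMap.comp_assoc, hH]
    congr 3
    ext i; fin_cases i <;> rfl
  simp only [LinearMap.smul_apply, LinearMap.comp_apply, push_of, TupleChain.map_of,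
    smul_smul, Function.comp_apply, hseg, ContinuousMap.comp_assoc, hH]
  rw [← w.seg_mul_seg G y₀ (H z₀) (H (u 0))]
  push_cast
  rfl

theorem push_comp_lin (G : C(Y, X)) (y₀ : Y) {m : ℕ} (v : Fin (m + 1) → Y)
    (c : TupleChain (Simplex m) (n + 1)) :
    (w.seg G y₀ (v 0) : ℤ) • push w (G.comp (lin v)) (vert 0) n c =
      push w G y₀ n (TupleChain.map (lin v) (n + 1) c) := by
  rw [← push_comp w G y₀ (lin v) (lin_lin v) (vert 0) c, lin_vert]

/-- The operator sending a singular simplex `σ` to the image under `σ` of a chain `c` of tuples in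
the standard simplex. -/
def simplexwise {m : ℕ} (c : TupleChain (Simplex n) (m + 1)) : Chain X n →ₗ[ℤ] Chain X m :=
  Finsupp.linearCombination ℤ fun σ => push w σ (vert 0) m c

/-- Barycentric subdivision. -/
def sd (n : ℕ) : Chain X n →ₗ[ℤ] Chain X n :=
  simplexwise w (TupleChain.sd bary (n + 1) (taut n))

/-- The chain homotopy from barycentric subdivision to the identity. -/
def sdHomotopy (n : ℕ) : Chain X n →ₗ[ℤ] Chain X (n + 1) :=
  simplexwise w (TupleChain.sdHomotopy bary (n + 1) (taut n))

theorem simplexwise_of {m : ℕ} (c : TupleChain (Simplex n) (m + 1)) (σ : C(Simplex n, X)) :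
    simplexwise w c (Chain.of σ) = push w σ (vert 0) m c := by
  simp [simplexwise]

theorem sd_of (σ : C(Simplex n, X)) : sd w n (Chain.of σ) =
    push w σ (vert 0) n (TupleChain.sd bary (n + 1) (taut n)) :=
  simplexwise_of w _ σ

theorem sdHomotopy_of (σ : C(Simplex n, X)) : sdHomotopy w n (Chain.of σ) =
    push w σ (vert 0) (n + 1) (TupleChain.sdHomotopy bary (n + 1) (taut n)) :=
  simplexwise_of w _ σ

theorem simplexwise_push {m : ℕ} {c : TupleChain (Simplex n) (m + 1)}
    {T : TupleChain Y (n + 1) →ₗ[ℤ] TupleChain Y (m + 1)}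
    (hT : ∀ v : Fin (n + 1) → Y, TupleChain.map (lin v) (m + 1) c = T (TupleChain.of v))
    (G : C(Y, X)) (y₀ : Y) (d : TupleChain Y (n + 1)) :
    simplexwise w c (push w G y₀ n d) = push w G y₀ m (T d) := by
  revert d
  suffices h : simplexwise w c ∘ₗ push w G y₀ n = push w G y₀ m ∘ₗ T from LinearMap.congr_fun h
  refine hom_ext_single fun v => ?_
  simp only [LinearMap.comp_apply, push_of, map_smul, simplexwise_of, push_comp_lin, hT]

theorem map_lin_taut (v : Fin (n + 1) → Y) :
    TupleChain.map (lin v) (n + 1) (taut n) = TupleChain.of v := by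
  rw [TupleChain.map_of]
  congr 1
  ext i
  simp [lin_vert]

theorem sd_push (G : C(Y, X)) (y₀ : Y) (c : TupleChain Y (n + 1)) :
    sd w n (push w G y₀ n c) = push w G y₀ n (TupleChain.sd bary (n + 1) c) :=
  simplexwise_push w (fun v => by rw [TupleChain.map_sd (lin_bary v), map_lin_taut]) G y₀ c

theorem sdHomotopy_push (G : C(Y, X)) (y₀ : Y) (c : TupleChain Y (n + 1)) :
    sdHomotopy w n (push w G y₀ n c) =
      push w G y₀ (n + 1) (TupleChain.sdHomotopy bary (n + 1) c) :=
  simplexwise_push w (fun v => by rw [TupleChain.map_sdHomotopy (lin_bary v), map_lin_taut]) G y₀ c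

theorem bd_sd (c : Chain X (n + 1)) : bd w n (sd w (n + 1) c) = sd w n (bd w n c) := by
  revert c
  suffices h : bd w n ∘ₗ sd w (n + 1) = sd w n ∘ₗ bd w n from LinearMap.congr_fun h
  refine hom_ext_single fun σ => ?_
  simp only [LinearMap.comp_apply, bd_eq_push, sd_of, bd_push, sd_push, TupleChain.bd_sd]

theorem bd_sdHomotopy (c : Chain X (n + 1)) :
    bd w (n + 1) (sdHomotopy w (n + 1) c) = c - sd w (n + 1) c - sdHomotopy w n (bd w n c) := by
  revert c
  suffices h : bd w (n + 1) ∘ₗ sdHomotopy w (n + 1) =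
      LinearMap.id - sd w (n + 1) - sdHomotopy w n ∘ₗ bd w n from LinearMap.congr_fun h
  refine hom_ext_single fun σ => ?_
  simp only [LinearMap.comp_apply, LinearMap.sub_apply, LinearMap.id_apply, bd_eq_push, sd_of,
    sdHomotopy_of, bd_push, sdHomotopy_push, TupleChain.bd_sdHomotopy, map_sub, push_taut]

end Affine

/-! ### The mesh of barycentric subdivision -/

theorem map_mem_of_mem_supported {ι R M : Type*} [Semiring R] [AddCommMonoid M] [Module R M]
    {s : Set ι} {f : (ι →₀ R) →ₗ[R] M} {N : Submodule R M}
    (h : ∀ i ∈ s, f (Finsupp.single i 1) ∈ N) {c : ι →₀ R} (hc : c ∈ Finsupp.supported R R s) :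
    f c ∈ N := by
  suffices hN : Finsupp.supported R R s ≤ N.comap f from hN hc
  rw [Finsupp.supported_eq_span_single, Submodule.span_le]
  exact Set.image_subset_iff.2 h

theorem lin_mem_of_convex {N k : ℕ} {C : Set (Fin (N + 1) → ℝ)} (hC : Convex ℝ C)
    {v : Fin (k + 1) → Simplex N} (hv : ∀ i, (v i).1 ∈ C) (t : Simplex k) : (lin v t).1 ∈ C := by
  rw [lin_simplex_coe]
  exact hC.sum_mem (fun i _ => t.2.1 i) t.2.2 fun i _ => hv i

theorem sd_of_mem_supported_of_convex {N : ℕ} {C : Set (Fin (N + 1) → ℝ)} (hC : Convex ℝ C) :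
    ∀ (k : ℕ) (v : Fin k → Simplex N), (∀ i, (v i).1 ∈ C) →
      TupleChain.sd bary k (TupleChain.of v) ∈ Finsupp.supported ℤ ℤ {u | ∀ i, (u i).1 ∈ C}
  | 0, v, _ => Finsupp.single_mem_supported ℤ 1 fun i => i.elim0
  | k + 1, v, hv => by
    rw [TupleChain.sd_succ_of, TupleChain.bd_of, map_sum, map_sum]
    refine Submodule.sum_mem _ fun i _ => ?_
    rw [map_smul, map_smul]
    refine Submodule.smul_mem _ _ (map_mem_of_mem_supported (fun u hu => ?_)
      (sd_of_mem_supported_of_convex hC k (v ∘ i.succAbove) fun _ => hv _))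
    rw [TupleChain.cone_of]
    exact Finsupp.single_mem_supported ℤ 1 (Fin.cases (lin_mem_of_convex hC hv _) hu)

theorem bary_coe {N k : ℕ} (v : Fin (k + 1) → Simplex N) :
    (bary k v).1 = ∑ i, ((k : ℝ) + 1)⁻¹ • (v i).1 := by
  rw [bary, lin_simplex_coe]
  refine Finset.sum_congr rfl fun i _ => ?_
  congr 1
  exact (stdSimplex.barycenter_apply i).trans (by simp)

theorem dist_bary_le {N k : ℕ} {v : Fin (k + 1) → Simplex N} {D : ℝ}
    (hD : ∀ i j, dist (v i) (v j) ≤ D) (i : Fin (k + 1)) :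
    dist (v i).1 (bary k v).1 ≤ k / (k + 1) * D := by
  have hk : (0 : ℝ) < k + 1 := by positivity
  have bary_sub : (bary k v).1 - (v i).1 = ∑ j, ((k : ℝ) + 1)⁻¹ • ((v j).1 - (v i).1) := by
    simp only [smul_sub, Finset.sum_sub_distrib, bary_coe, Finset.sum_const, Finset.card_univ,
      Fintype.card_fin]
    rw [← Nat.cast_smul_eq_nsmul ℝ, smul_smul]
    push_cast
    rw [mul_inv_cancel₀ hk.ne', one_smul]
  rw [dist_comm, dist_eq_norm, bary_sub]
  refine (norm_sum_le _ _).trans ?_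
  rw [← Finset.sum_erase (a := i) _ (by simp)]
  refine (Finset.sum_le_card_nsmul _ _ (((k : ℝ) + 1)⁻¹ * D) fun j _ => ?_).trans (le_of_eq ?_)
  · rw [norm_smul, Real.norm_of_nonneg (by positivity), ← dist_eq_norm]
    exact mul_le_mul_of_nonneg_left (hD j i) (by positivity)
  · rw [Finset.card_erase_of_mem (Finset.mem_univ i), Finset.card_univ, Fintype.card_fin,
      Nat.add_sub_cancel, nsmul_eq_mul]
    ring

theorem dist_cons_le {Z : Type*} [PseudoMetricSpace Z] {k : ℕ} {b : Z} {u : Fin k → Z} {r : ℝ}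
    (hr : 0 ≤ r) (hb : ∀ i, dist (u i) b ≤ r) (hu : ∀ i j, dist (u i) (u j) ≤ r) :
    ∀ i j, dist ((Fin.cons b u : Fin (k + 1) → Z) i) ((Fin.cons b u : Fin (k + 1) → Z) j) ≤ r :=
  Fin.cases (Fin.cases ((dist_self b).trans_le hr) fun j => (dist_comm b (u j)).trans_le (hb j))
    fun i => Fin.cases (hb i) (hu i)

theorem sd_of_mem_supported_of_dist_le {N : ℕ} {D r : ℝ} : ∀ (k : ℕ) (v : Fin k → Simplex N),
    (∀ i j, dist (v i) (v j) ≤ D) → (∀ j < k, (j : ℝ) / (j + 1) * D ≤ r) →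
      TupleChain.sd bary k (TupleChain.of v) ∈
        Finsupp.supported ℤ ℤ {u | ∀ i j, dist (u i) (u j) ≤ r}
  | 0, v, _, _ => Finsupp.single_mem_supported ℤ 1 fun i => i.elim0
  | k + 1, v, hv, hr => by
    have hr₀ : 0 ≤ r := by simpa using hr 0 k.succ_pos
    have mem_ball (i) : (v i).1 ∈ Metric.closedBall (bary k v).1 r :=
      (dist_bary_le hv i).trans (hr k k.lt_succ_self)
    rw [TupleChain.sd_succ_of, TupleChain.bd_of, map_sum, map_sum]
    refine Submodule.sum_mem _ fun i _ => ?_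
    rw [map_smul, map_smul]
    refine Submodule.smul_mem _ _ (map_mem_of_mem_supported (fun u hu => ?_)
      ((Finsupp.supported_inter _ _).ge
        ⟨sd_of_mem_supported_of_dist_le k (v ∘ i.succAbove) (fun _ _ => hv _ _) fun j hj =>
          hr j (hj.trans k.lt_succ_self),
        sd_of_mem_supported_of_convex (convex_closedBall (bary k v).1 r) k (v ∘ i.succAbove)
          fun _ => mem_ball _⟩))
    rw [TupleChain.cone_of]
    exact Finsupp.single_mem_supported ℤ 1 (dist_cons_le hr₀ hu.2 hu.1)

theorem dist_simplex_le_one {N : ℕ} (s t : Simplex N) : dist s t ≤ 1 := by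
  rw [Subtype.dist_eq, dist_pi_le_iff zero_le_one]
  exact fun i => Real.dist_le_of_mem_Icc_01 (mem_Icc_of_mem_stdSimplex s.2 i)
    (mem_Icc_of_mem_stdSimplex t.2 i)

theorem sd_pow_taut_mem_supported (n m : ℕ) :
    (TupleChain.sd bary (n + 1) ^ m) (taut n) ∈ Finsupp.supported ℤ ℤ
      {u | ∀ i j, dist (u i) (u j) ≤ ((n : ℝ) / (n + 1)) ^ m} := by
  induction m with
  | zero => exact Finsupp.single_mem_supported ℤ 1 fun i j => by simpa using dist_simplex_le_one _ _
  | succ m ih =>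
    rw [pow_succ' (TupleChain.sd bary (n + 1)), Module.End.mul_apply]
    refine map_mem_of_mem_supported (fun u hu => ?_) ih
    refine sd_of_mem_supported_of_dist_le (n + 1) u hu fun j hj => ?_
    rw [pow_succ']
    refine mul_le_mul_of_nonneg_right ?_ (by positivity)
    have hjn : (j : ℝ) ≤ n := by exact_mod_cast Nat.lt_succ_iff.1 hj
    rw [div_le_div_iff₀ (by positivity) (by positivity)]
    linarith

/-! ### Chains supported in a subset -/

/-- The singular simplices with image in `A`. -/
def inSet (A : Set X) (n : ℕ) : Set C(Simplex n, X) := {σ | ∀ t, σ t ∈ A}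

/-- The singular simplices with image in one of two sets. -/
def small (U V : Set X) (n : ℕ) : Set C(Simplex n, X) := inSet U n ∪ inSet V n

/-- The chains supported on a set of simplices. -/
abbrev supp {n : ℕ} (S : Set C(Simplex n, X)) : Submodule ℤ (Chain X n) :=
  Finsupp.supported ℤ ℤ S

theorem inSet_mono {A B : Set X} (h : A ⊆ B) (n : ℕ) : inSet A n ⊆ inSet B n :=
  fun _ hσ t => h (hσ t)

section Supports

variable {Y : Type*} [TopologicalSpace Y] [AffineSimplices Y] (w : Twist X) {n : ℕ}

theorem push_mem_supp {A : Set X} {G : C(Y, X)} (hG : ∀ y, G y ∈ A) (y₀ : Y)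
    (c : TupleChain Y (n + 1)) : push w G y₀ n c ∈ supp (inSet A n) := by
  refine map_mem_of_mem_supported (s := Set.univ) (fun v _ => ?_) (by simp)
  rw [push_of]
  exact Submodule.smul_mem _ _ (Finsupp.single_mem_supported ℤ 1 fun t => hG _)

theorem bd_mem_supp {A : Set X} {c : Chain X (n + 1)} (hc : c ∈ supp (inSet A (n + 1))) :
    bd w n c ∈ supp (inSet A n) := by
  refine map_mem_of_mem_supported (fun σ hσ => ?_) hc
  rw [bd_eq_push]
  exact push_mem_supp w hσ _ _

theorem simplexwise_mem_supp {m : ℕ} (c : TupleChain (Simplex n) (m + 1)) {A : Set X}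
    {d : Chain X n} (hd : d ∈ supp (inSet A n)) : simplexwise w c d ∈ supp (inSet A m) := by
  refine map_mem_of_mem_supported (fun σ hσ => ?_) hd
  rw [simplexwise_of]
  exact push_mem_supp w hσ _ _

theorem simplexwise_mem_supp_small {m : ℕ} (c : TupleChain (Simplex n) (m + 1)) {U V : Set X}
    {d : Chain X n} (hd : d ∈ supp (small U V n)) : simplexwise w c d ∈ supp (small U V m) := by
  refine map_mem_of_mem_supported ?_ hd
  rintro σ (hσ | hσ)
  · exact Finsupp.supported_mono Set.subset_union_left
      (simplexwise_mem_supp w c (Finsupp.single_mem_supported ℤ 1 hσ))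
  · exact Finsupp.supported_mono Set.subset_union_right
      (simplexwise_mem_supp w c (Finsupp.single_mem_supported ℤ 1 hσ))

theorem sd_pow_mem_supp {A : Set X} {c : Chain X n} (hc : c ∈ supp (inSet A n)) (m : ℕ) :
    (sd w n ^ m) c ∈ supp (inSet A n) :=
  Module.End.pow_apply_mem_of_forall_mem m (fun _ => simplexwise_mem_supp w _) c hc

theorem bd_sd_pow (c : Chain X (n + 1)) (m : ℕ) :
    bd w n ((sd w (n + 1) ^ m) c) = (sd w n ^ m) (bd w n c) :=
  have h : sd w n ∘ₗ bd w n = bd w n ∘ₗ sd w (n + 1) := LinearMap.ext fun c => (bd_sd w c).symm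
  LinearMap.congr_fun (Module.End.commute_pow_left_of_commute h m).symm c

theorem sd_pow_of (σ : C(Simplex n, X)) (m : ℕ) : (sd w n ^ m) (Chain.of σ) =
    push w σ (vert 0) n ((TupleChain.sd bary (n + 1) ^ m) (taut n)) := by
  have h : sd w n ∘ₗ push w σ (vert 0) n = push w σ (vert 0) n ∘ₗ TupleChain.sd bary (n + 1) :=
    LinearMap.ext fun c => sd_push w σ (vert 0) c
  rw [← push_taut w]
  exact LinearMap.congr_fun (Module.End.commute_pow_left_of_commute h m) (taut n)

end Supports

/-- `A` is the union of the relatively open subsets `U` and `V`. -/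
structure IsRelOpenCover (A U V : Set X) : Prop where
  left : ∃ O, IsOpen O ∧ U = A ∩ O
  right : ∃ O, IsOpen O ∧ V = A ∩ O
  subset : A ⊆ U ∪ V

theorem IsRelOpenCover.exists_ball {A U V : Set X} (h : IsRelOpenCover A U V) {n : ℕ}
    {σ : C(Simplex n, X)} (hσ : σ ∈ inSet A n) :
    ∃ δ > 0, ∀ x, (∀ y ∈ Metric.ball x δ, σ y ∈ U) ∨ ∀ y ∈ Metric.ball x δ, σ y ∈ V := by
  obtain ⟨⟨O₁, hO₁, rfl⟩, ⟨O₂, hO₂, rfl⟩, hA⟩ := h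
  obtain ⟨δ, hδ, hball⟩ := lebesgue_number_lemma_of_metric (s := (Set.univ : Set (Simplex n)))
    (c := fun b : Bool => σ ⁻¹' (cond b O₁ O₂)) isCompact_univ
    (Bool.forall_bool.2 ⟨hO₂.preimage σ.continuous, hO₁.preimage σ.continuous⟩)
    (fun x _ => Set.mem_iUnion.2 <| Bool.exists_bool.2 <|
      (hA (hσ x)).symm.imp (fun hx => hx.2) (fun hx => hx.2))
  refine ⟨δ, hδ, fun x => ?_⟩
  obtain ⟨_ | _, hb⟩ := hball x trivial
  · exact Or.inr fun y hy => ⟨hσ y, hb hy⟩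
  · exact Or.inl fun y hy => ⟨hσ y, hb hy⟩

theorem exists_sd_pow_mem_small (w : Twist X) {A U V : Set X} (h : IsRelOpenCover A U V) {n : ℕ}
    {σ : C(Simplex n, X)} (hσ : σ ∈ inSet A n) :
    ∃ N, ∀ m ≥ N, (sd w n ^ m) (Chain.of σ) ∈ supp (small U V n) := by
  obtain ⟨δ, hδ, hball⟩ := h.exists_ball hσ
  have hlt : (n : ℝ) / (n + 1) < 1 := by rw [div_lt_one (by positivity)]; linarith
  obtain ⟨N, hN⟩ := exists_pow_lt_of_lt_one hδ hlt
  refine ⟨N, fun m hm => ?_⟩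
  rw [sd_pow_of]
  refine map_mem_of_mem_supported (fun u hu => ?_) (sd_pow_taut_mem_supported n m)
  have hu_ball (t) : lin u t ∈ Metric.ball (u 0) δ :=
    lin_mem_of_convex (convex_ball (u 0).1 δ) (fun i => (hu i 0).trans_lt
      ((pow_le_pow_of_le_one (by positivity) hlt.le hm).trans_lt hN)) t
  rw [push_of]
  exact Submodule.smul_mem _ _ (Finsupp.single_mem_supported ℤ 1
    ((hball (u 0)).imp (fun hU t => hU _ (hu_ball t)) fun hV t => hV _ (hu_ball t)))

/-! ### Cohomology of a family of simplices -/

/-- Integral singular cochains. -/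
abbrev Cochain (X : Type*) [TopologicalSpace X] (n : ℕ) : Type _ := Module.Dual ℤ (Chain X n)

/-- The coboundary of singular cochains twisted by `w`. -/
def coboundary (w : Twist X) (n : ℕ) : Cochain X n →ₗ[ℤ] Cochain X (n + 1) := (bd w n).dualMap

/-- The cochains whose coboundary vanishes on the simplices in `S`. -/
def cocycles (w : Twist X) (S : ∀ n, Set C(Simplex n, X)) (n : ℕ) : Submodule ℤ (Cochain X n) :=
  (supp (S (n + 1))).dualAnnihilator.comap (coboundary w n)

/-- The cochains that agree with a coboundary on the simplices in `S`. -/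
def coboundaries (w : Twist X) (S : ∀ n, Set C(Simplex n, X)) :
    (n : ℕ) → Submodule ℤ (Cochain X n)
  | 0 => (supp (S 0)).dualAnnihilator
  | n + 1 => LinearMap.range (coboundary w n) ⊔ (supp (S (n + 1))).dualAnnihilator

section Cohomology

variable {w : Twist X} {n : ℕ} {S : ∀ n, Set C(Simplex n, X)}

@[simp] theorem coboundary_apply (φ : Cochain X n) (c : Chain X (n + 1)) :
    coboundary w n φ c = φ (bd w n c) := rfl

theorem mem_dualAnnihilator_supp {T : Set C(Simplex n, X)} {φ : Cochain X n} :
    φ ∈ (supp T).dualAnnihilator ↔ ∀ σ ∈ T, φ (Chain.of σ) = 0 := by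
  rw [Submodule.mem_dualAnnihilator]
  exact ⟨fun h σ hσ => h _ (Finsupp.single_mem_supported ℤ 1 hσ),
    fun h c hc => map_mem_of_mem_supported (N := ⊥) h hc⟩

theorem mem_cocycles_iff {φ : Cochain X n} :
    φ ∈ cocycles w S n ↔ ∀ σ ∈ S (n + 1), φ (bd w n (Chain.of σ)) = 0 :=
  mem_dualAnnihilator_supp

theorem apply_bd_eq_zero {φ : Cochain X n} (hφ : φ ∈ cocycles w S n) {c : Chain X (n + 1)}
    (hc : c ∈ supp (S (n + 1))) : φ (bd w n c) = 0 :=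
  (Submodule.mem_dualAnnihilator _).1 hφ c hc

theorem mem_coboundaries_succ_iff {φ : Cochain X (n + 1)} : φ ∈ coboundaries w S (n + 1) ↔
    ∃ ψ : Cochain X n, ∀ σ ∈ S (n + 1), φ (Chain.of σ) = ψ (bd w n (Chain.of σ)) := by
  simp only [coboundaries, Submodule.mem_sup, LinearMap.mem_range, exists_exists_eq_and]
  refine exists_congr fun ψ => ⟨?_, fun h => ⟨φ - coboundary w n ψ, ?_, add_sub_cancel _ _⟩⟩
  · rintro ⟨ζ, hζ, rfl⟩ σ hσ
    simp [mem_dualAnnihilator_supp.1 hζ σ hσ]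
  · exact mem_dualAnnihilator_supp.2 fun σ hσ => by simp [h σ hσ]

theorem coboundary_mem_cocycles (ψ : Cochain X n) :
    coboundary w n ψ ∈ cocycles w S (n + 1) :=
  mem_cocycles_iff.2 fun σ _ => by simp [bd_bd]

theorem cocycles_anti {T : ∀ n, Set C(Simplex n, X)} (h : S (n + 1) ⊆ T (n + 1)) :
    cocycles w T n ≤ cocycles w S n :=
  Submodule.comap_mono (Submodule.dualAnnihilator_anti (Finsupp.supported_mono h))

end Cohomology

/-! ### Small simplices -/

theorem exists_linearMap_eventually_eq_sum {ι R M : Type*} [Semiring R] [AddCommMonoid M]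
    [Module R M] {s : Set ι} {f : ℕ → (ι →₀ R) →ₗ[R] M}
    (hf : ∀ i ∈ s, ∀ᶠ m in Filter.atTop, f m (Finsupp.single i 1) = 0) :
    ∃ g : (ι →₀ R) →ₗ[R] M, ∀ c ∈ Finsupp.supported R R s,
      ∀ᶠ m in Filter.atTop, g c = ∑ j ∈ Finset.range m, f j c := by
  have exists_bound (i : ι) : ∃ N, i ∈ s → ∀ m ≥ N, f m (Finsupp.single i 1) = 0 := by
    by_cases hi : i ∈ s
    · exact (Filter.eventually_atTop.1 (hf i hi)).imp fun N hN _ => hN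
    · exact ⟨0, fun h => (hi h).elim⟩
  choose N hN using exists_bound
  refine ⟨Finsupp.linearCombination R fun i => ∑ j ∈ Finset.range (N i), f j (Finsupp.single i 1),
    fun c hc => ?_⟩
  rw [Finsupp.supported_eq_span_single] at hc
  induction hc using Submodule.span_induction with
  | mem x hx =>
    obtain ⟨i, hi, rfl⟩ := hx
    filter_upwards [Filter.eventually_ge_atTop (N i)] with m hm
    rw [Finsupp.linearCombination_single, one_smul]
    exact Finset.sum_subset (Finset.range_mono hm) fun j _ hj => hN i hi j (by simpa using hj)
  | zero => simp
  | add x y _ _ hx hy =>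
    filter_upwards [hx, hy] with m hx hy
    simp only [map_add, Finset.sum_add_distrib, hx, hy]
  | smul a x _ hx =>
    filter_upwards [hx] with m hx
    simp only [map_smul, ← Finset.smul_sum, hx]

section SmallSimplices

variable {w : Twist X} {n : ℕ} {A U V : Set X}

theorem IsRelOpenCover.inSet_zero_subset (h : IsRelOpenCover A U V) :
    inSet A 0 ⊆ small U V 0 := by
  intro σ hσ
  have const (t : Simplex 0) : σ t = σ (vert 0) := congrArg σ (Subsingleton.elim _ _)
  exact (h.subset (hσ (vert 0))).imp (fun hU t => (const t).symm ▸ hU)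
    fun hV t => (const t).symm ▸ hV

theorem apply_sdHomotopy_sd_pow_bd {θ : Cochain X (n + 1)} (hθ : θ ∈ cocycles w (inSet A) (n + 1))
    {c : Chain X (n + 1)} (hc : c ∈ supp (inSet A (n + 1))) (i : ℕ) :
    θ (sdHomotopy w n ((sd w n ^ i) (bd w n c))) =
      θ ((sd w (n + 1) ^ i) c) - θ ((sd w (n + 1) ^ (i + 1)) c) := by
  have h : θ (bd w (n + 1) (sdHomotopy w (n + 1) ((sd w (n + 1) ^ i) c))) = 0 :=
    apply_bd_eq_zero hθ (simplexwise_mem_supp w _ (sd_pow_mem_supp w hc i))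
  rw [bd_sdHomotopy, map_sub, map_sub, bd_sd_pow] at h
  rw [pow_succ', Module.End.mul_apply]
  linarith

/-- If a cocycle `θ` vanishes on small simplices, the telescoping sum `∑ᵢ θ ∘ D ∘ sdⁱ`, where `D` is
the chain homotopy from the subdivision to the identity, is finite on each simplex, and its
coboundary is `θ`. -/
theorem mem_coboundaries_of_vanish_on_small (h : IsRelOpenCover A U V)
    {θ : Cochain X (n + 1)} (hθ : θ ∈ cocycles w (inSet A) (n + 1))
    (hsmall : θ ∈ (supp (small U V (n + 1))).dualAnnihilator) :
    θ ∈ coboundaries w (inSet A) (n + 1) := by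
  rw [Submodule.mem_dualAnnihilator] at hsmall
  obtain ⟨ψ, hψ⟩ := exists_linearMap_eventually_eq_sum (s := inSet A n)
    (f := fun i => θ ∘ₗ sdHomotopy w n ∘ₗ (sd w n ^ i)) fun τ hτ => by
      filter_upwards [Filter.eventually_atTop.2 (exists_sd_pow_mem_small w h hτ)] with i hi
      exact hsmall _ (simplexwise_mem_supp_small w _ hi)
  refine mem_coboundaries_succ_iff.2 ⟨ψ, fun σ hσ => ?_⟩
  have hσ_supp : Chain.of σ ∈ supp (inSet A (n + 1)) := Finsupp.single_mem_supported ℤ 1 hσ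
  obtain ⟨m, hsum, hm⟩ := ((hψ _ (bd_mem_supp w hσ_supp)).and
    (Filter.eventually_atTop.2 (exists_sd_pow_mem_small w h hσ))).exists
  simp only [LinearMap.comp_apply, apply_sdHomotopy_sd_pow_bd hθ hσ_supp] at hsum
  rw [hsum, Finset.sum_range_sub', hsmall _ hm, pow_zero, Module.End.one_apply, sub_zero]

theorem cocycles_inf_coboundaries_small_le (h : IsRelOpenCover A U V) (n : ℕ) :
    cocycles w (inSet A) n ⊓ coboundaries w (small U V) n ≤ coboundaries w (inSet A) n := by
  rintro φ ⟨hφ, hφ_small⟩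
  rcases n with _ | n
  · exact Submodule.dualAnnihilator_anti (Finsupp.supported_mono h.inSet_zero_subset) hφ_small
  obtain ⟨_, ⟨ψ, rfl⟩, θ, hθ, rfl⟩ := Submodule.mem_sup.1 hφ_small
  exact add_mem (Submodule.mem_sup_left ⟨ψ, rfl⟩) (mem_coboundaries_of_vanish_on_small h
    ((Submodule.add_mem_iff_right _ (coboundary_mem_cocycles ψ)).1 hφ) hθ)

end SmallSimplices

/-! ### Deformations -/

section Deformations

variable {A B : Set X} {n m : ℕ}

/-- The homotopy `F` applied to a simplex in `A`. -/
def homotopySimplex (F : C(A × unitInterval, X)) {σ : C(Simplex n, X)} (hσ : σ ∈ inSet A n) :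
    C(Simplex n × unitInterval, X) :=
  F.comp ((⟨fun t => ⟨σ t, hσ t⟩, by fun_prop⟩ : C(Simplex n, A)).prodMap (ContinuousMap.id _))

open Classical in
/-- The operator on chains in `A` induced by the homotopy `F` and a chain of tuples in the prism
over the standard simplex. -/
def homotopyOp (w : Twist X) (F : C(A × unitInterval, X))
    (Θ : TupleChain (Simplex n × unitInterval) (m + 1)) : Chain X n →ₗ[ℤ] Chain X m :=
  Finsupp.linearCombination ℤ fun σ =>
    if h : σ ∈ inSet A n then push w (homotopySimplex F h) (vert 0, 0) m Θ else 0

/-- The chain map induced by the final map of the homotopy `F`. -/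
def homotopyEnd (w : Twist X) (F : C(A × unitInterval, X)) (n : ℕ) : Chain X n →ₗ[ℤ] Chain X n :=
  homotopyOp w F (TupleChain.map (·, (1 : unitInterval)) (n + 1) (taut n))

/-- The chain homotopy induced by the homotopy `F`. -/
def chainHomotopy (w : Twist X) (F : C(A × unitInterval, X)) (n : ℕ) :
    Chain X n →ₗ[ℤ] Chain X (n + 1) :=
  homotopyOp w F (TupleChain.prism 0 1 (n + 1) (taut n))

/-- The homotopy `F` deforms `A` into `B` within `A`; it need not fix `B`. -/
structure IsDeformation (F : C(A × unitInterval, X)) (B : Set X) : Prop where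
  mem p : F p ∈ A
  start a : F (a, 0) = a
  finish a : F (a, 1) ∈ B

theorem lin_const {Y : Type*} [TopologicalSpace Y] [AffineSimplices Y] (y : Y) (t : Simplex m) :
    lin (fun _ => y) t = y := by
  have h := DFunLike.congr_fun (lin_comp_simplexMap (fun _ : Fin 1 => y) fun _ : Fin (m + 1) => 0) t
  refine h.symm.trans ?_
  rw [ContinuousMap.comp_apply,
    Subsingleton.elim (simplexMap (fun _ : Fin (m + 1) => (0 : Fin 1)) t) (vert 0)]
  exact lin_vert (fun _ : Fin 1 => y) 0

theorem lin_slice {Y : Type*} [TopologicalSpace Y] [AffineSimplices Y] (u : Fin (m + 1) → Y)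
    (s : unitInterval) (t : Simplex m) : lin (fun i => (u i, s)) t = (lin u t, s) :=
  Prod.ext rfl (lin_const s t)

variable {w : Twist X} {F : C(A × unitInterval, X)}

theorem homotopyOp_of (Θ : TupleChain (Simplex n × unitInterval) (m + 1)) {σ : C(Simplex n, X)}
    (hσ : σ ∈ inSet A n) :
    homotopyOp w F Θ (Chain.of σ) = push w (homotopySimplex F hσ) (vert 0, 0) m Θ := by
  simp [homotopyOp, hσ]

namespace IsDeformation

theorem homotopySimplex_comp_lin (hF : IsDeformation F B) {σ : C(Simplex n, X)}
    (hσ : σ ∈ inSet A n) (u : Fin (m + 1) → Simplex n) :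
    (homotopySimplex F hσ).comp (lin fun i => (u i, 0)) = σ.comp (lin u) := by
  ext t
  simp only [ContinuousMap.comp_apply, lin_slice]
  exact hF.start _

theorem seg_homotopySimplex (hF : IsDeformation F B) {σ : C(Simplex n, X)}
    (hσ : σ ∈ inSet A n) (s t : Simplex n) :
    w.seg (homotopySimplex F hσ) (s, 0) (t, 0) = w.seg σ s t := by
  rw [Twist.seg, Twist.seg, ← hF.homotopySimplex_comp_lin hσ]
  congr 3
  ext j : 1
  fin_cases j <;> rfl

theorem homotopyOp_bd (hF : IsDeformation F B)
    {Θ : TupleChain (Simplex n × unitInterval) (m + 1)}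
    {T : TupleChain (Simplex (n + 1)) (n + 1) →ₗ[ℤ]
      TupleChain (Simplex (n + 1) × unitInterval) (m + 1)}
    (hT : ∀ v, TupleChain.map (Prod.map (lin v) id) (m + 1) Θ = T (TupleChain.of v))
    {σ : C(Simplex (n + 1), X)} (hσ : σ ∈ inSet A (n + 1)) :
    homotopyOp w F Θ (bd w n (Chain.of σ)) =
      push w (homotopySimplex F hσ) (vert 0, 0) m (T (TupleChain.bd (n + 1) (taut (n + 1)))) := by
  simp only [bd_of, TupleChain.bd_of, map_sum, map_smul, ← hT]
  refine Finset.sum_congr rfl fun i _ => ?_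
  have hi : σ.comp (simplexMap i.succAbove) ∈ inSet A n := fun t => hσ _
  rw [homotopyOp_of Θ hi, mul_smul]
  congr 1
  let H : C(Simplex n × unitInterval, Simplex (n + 1) × unitInterval) :=
    (lin fun j => vert (i.succAbove j)).prodMap (ContinuousMap.id _)
  have face : homotopySimplex F hi = (homotopySimplex F hσ).comp H := by
    ext t
    simp only [homotopySimplex, H, lin_vert_comp]
    rfl
  have H_vert : H (vert 0, 0) = (vert (i.succAbove 0), 0) :=
    Prod.ext (lin_vert (fun j => vert (i.succAbove j)) 0) rfl
  rw [face, ← hF.seg_homotopySimplex hσ, ← H_vert]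
  refine push_comp w (homotopySimplex F hσ) (vert 0, 0) H (fun u => ?_) (vert 0, 0) Θ
  ext t : 1
  exact Prod.ext (DFunLike.congr_fun (lin_lin _ (Prod.fst ∘ u)) t) rfl

theorem bd_homotopyEnd (hF : IsDeformation F B) {σ : C(Simplex (n + 1), X)}
    (hσ : σ ∈ inSet A (n + 1)) :
    bd w n (homotopyEnd w F (n + 1) (Chain.of σ)) = homotopyEnd w F n (bd w n (Chain.of σ)) := by
  rw [homotopyEnd, homotopyEnd, homotopyOp_of _ hσ, bd_push, TupleChain.bd_map]
  refine (hF.homotopyOp_bd (T := TupleChain.map (·, 1) (n + 1)) (fun v => ?_) hσ).symm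
  rw [TupleChain.map_of, TupleChain.map_of, TupleChain.map_of]
  congr 1
  ext j : 1
  exact Prod.ext (lin_vert v j) rfl

theorem bd_chainHomotopy (hF : IsDeformation F B) {σ : C(Simplex n, X)} (hσ : σ ∈ inSet A n) :
    bd w n (chainHomotopy w F n (Chain.of σ)) = homotopyEnd w F n (Chain.of σ) - Chain.of σ -
      push w (homotopySimplex F hσ) (vert 0, 0) n
        (TupleChain.prism 0 1 n (TupleChain.bd n (taut n))) := by
  rw [chainHomotopy, homotopyEnd, homotopyOp_of _ hσ, homotopyOp_of _ hσ, bd_push,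
    TupleChain.bd_prism, map_sub, map_sub]
  congr 2
  have start := hF.homotopySimplex_comp_lin hσ fun i => vert i
  rw [lin_vert_eq_id] at start
  rw [TupleChain.map_of, push_of]
  simp only [Function.comp_apply, Twist.seg_self, Units.val_one, one_smul]
  exact congrArg Chain.of start

theorem bd_chainHomotopy_zero (hF : IsDeformation F B) {σ : C(Simplex 0, X)}
    (hσ : σ ∈ inSet A 0) :
    bd w 0 (chainHomotopy w F 0 (Chain.of σ)) = homotopyEnd w F 0 (Chain.of σ) - Chain.of σ := by
  rw [hF.bd_chainHomotopy hσ]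
  exact sub_eq_self.2 (map_zero _)

theorem bd_chainHomotopy_succ (hF : IsDeformation F B) {σ : C(Simplex (n + 1), X)}
    (hσ : σ ∈ inSet A (n + 1)) :
    bd w (n + 1) (chainHomotopy w F (n + 1) (Chain.of σ)) =
      homotopyEnd w F (n + 1) (Chain.of σ) - Chain.of σ -
        chainHomotopy w F n (bd w n (Chain.of σ)) := by
  rw [hF.bd_chainHomotopy hσ, chainHomotopy.eq_1 w F n, hF.homotopyOp_bd (fun v => ?_) hσ]
  rw [TupleChain.map_prism, map_lin_taut]

theorem chainHomotopy_mem_supp (hF : IsDeformation F B) {σ : C(Simplex n, X)}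
    (hσ : σ ∈ inSet A n) : chainHomotopy w F n (Chain.of σ) ∈ supp (inSet A (n + 1)) := by
  rw [chainHomotopy, homotopyOp_of _ hσ]
  exact push_mem_supp w (G := homotopySimplex F hσ) (fun y => hF.mem _) _ _

theorem homotopyEnd_mem_supp (hF : IsDeformation F B) {σ : C(Simplex n, X)}
    (hσ : σ ∈ inSet A n) : homotopyEnd w F n (Chain.of σ) ∈ supp (inSet B n) := by
  rw [homotopyEnd, homotopyOp_of _ hσ, TupleChain.map_of, push_of]
  refine Submodule.smul_mem _ _ (Finsupp.single_mem_supported ℤ 1 fun t => ?_)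
  have slice : lin ((fun x => (x, (1 : unitInterval))) ∘ fun i : Fin (n + 1) => vert i) t =
    (lin (fun i => vert i) t, 1) := lin_slice _ 1 t
  rw [ContinuousMap.comp_apply, slice]
  exact hF.finish _

theorem cocycles_inf_coboundaries_le (hF : IsDeformation F B) (n : ℕ) :
    cocycles w (inSet A) n ⊓ coboundaries w (inSet B) n ≤ coboundaries w (inSet A) n := by
  rintro φ ⟨hφ, hφB⟩
  have zero_on_bd {σ : C(Simplex n, X)} (hσ : σ ∈ inSet A n) :
      φ (bd w n (chainHomotopy w F n (Chain.of σ))) = 0 :=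
    apply_bd_eq_zero hφ (hF.chainHomotopy_mem_supp hσ)
  rcases n with _ | n
  · refine mem_dualAnnihilator_supp.2 fun σ hσ => ?_
    have hend : φ (homotopyEnd w F 0 (Chain.of σ)) = 0 :=
      (Submodule.mem_dualAnnihilator _).1 hφB _ (hF.homotopyEnd_mem_supp hσ)
    simpa [hF.bd_chainHomotopy_zero hσ, hend] using zero_on_bd hσ
  · obtain ⟨_, ⟨ψ, rfl⟩, ζ, hζ, rfl⟩ := Submodule.mem_sup.1 hφB
    set φ := coboundary w n ψ + ζ
    refine mem_coboundaries_succ_iff.2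
      ⟨ψ ∘ₗ homotopyEnd w F n - φ ∘ₗ chainHomotopy w F n, fun σ hσ => ?_⟩
    have hend : φ (homotopyEnd w F (n + 1) (Chain.of σ)) =
        ψ (homotopyEnd w F n (bd w n (Chain.of σ))) := by
      rw [LinearMap.add_apply, coboundary_apply, hF.bd_homotopyEnd hσ,
        (Submodule.mem_dualAnnihilator _).1 hζ _ (hF.homotopyEnd_mem_supp hσ), add_zero]
    have h := zero_on_bd hσ
    rw [hF.bd_chainHomotopy_succ hσ, map_sub, map_sub, hend] at h
    simp only [LinearMap.sub_apply, LinearMap.comp_apply]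
    linarith

end IsDeformation

end Deformations

/-! ### The Mayer-Vietoris connecting map -/

section Connecting

variable {n : ℕ} {U V : Set X}

open Classical in
/-- The projection of chains onto the chains supported on a set of simplices. -/
def proj (S : Set C(Simplex n, X)) : Chain X n →ₗ[ℤ] Chain X n :=
  (supp S).subtype ∘ₗ Finsupp.restrictDom ℤ ℤ S

theorem proj_mem_supp (S : Set C(Simplex n, X)) (c : Chain X n) : proj S c ∈ supp S :=
  Subtype.property _

theorem proj_eq_self {S : Set C(Simplex n, X)} {c : Chain X n} (hc : c ∈ supp S) :
    proj S c = c := by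
  classical
  exact Finsupp.filter_eq_self_iff _ _ |>.2 fun σ hσ => hc (Finsupp.mem_support_iff.2 hσ)

theorem proj_of_notMem {S : Set C(Simplex n, X)} {σ : C(Simplex n, X)} (hσ : σ ∉ S) :
    proj S (Chain.of σ) = 0 := by
  classical
  exact Finsupp.filter_single_of_neg _ hσ

theorem proj_mem_supp_inter {c : Chain X n} (hc : c ∈ supp (inSet U n)) :
    proj (inSet V n) c ∈ supp (inSet (U ∩ V) n) := by
  refine map_mem_of_mem_supported (fun σ hσ => ?_) hc
  by_cases hV : σ ∈ inSet V n
  · rw [proj_eq_self (Finsupp.single_mem_supported ℤ 1 hV)]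
    exact Finsupp.single_mem_supported ℤ 1 fun t => ⟨hσ t, hV t⟩
  · rw [proj_of_notMem hV]
    exact zero_mem _

/-- The connecting map of the Mayer-Vietoris sequence of `U` and `V` on cochains. -/
def connecting (w : Twist X) (U V : Set X) (n : ℕ) : Cochain X n →ₗ[ℤ] Cochain X (n + 1) :=
  (proj (inSet V n) ∘ₗ bd w n ∘ₗ proj (inSet U (n + 1))).dualMap

variable {w : Twist X}

theorem connecting_of_mem_left (χ : Cochain X n) {σ : C(Simplex (n + 1), X)}
    (hσ : σ ∈ inSet U (n + 1)) :
    connecting w U V n χ (Chain.of σ) = χ (proj (inSet V n) (bd w n (Chain.of σ))) := by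
  simp [connecting, proj_eq_self (Finsupp.single_mem_supported ℤ 1 hσ)]

theorem connecting_of_mem_right {χ : Cochain X n} (hχ : χ ∈ cocycles w (inSet (U ∩ V)) n)
    {σ : C(Simplex (n + 1), X)} (hσ : σ ∈ inSet V (n + 1)) :
    connecting w U V n χ (Chain.of σ) = 0 := by
  by_cases hU : σ ∈ inSet U (n + 1)
  · rw [connecting_of_mem_left χ hU,
      proj_eq_self (bd_mem_supp w (Finsupp.single_mem_supported ℤ 1 hσ))]
    exact mem_cocycles_iff.1 hχ σ fun t => ⟨hU t, hσ t⟩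
  · simp [connecting, proj_of_notMem hU]

theorem exists_sub_connecting_mem {φ : Cochain X (n + 1)}
    (hU : φ ∈ coboundaries w (inSet U) (n + 1)) (hV : φ ∈ coboundaries w (inSet V) (n + 1)) :
    ∃ χ ∈ cocycles w (inSet (U ∩ V)) n,
      φ - connecting w U V n χ ∈ coboundaries w (small U V) (n + 1) := by
  obtain ⟨ψ₁, h₁⟩ := mem_coboundaries_succ_iff.1 hU
  obtain ⟨ψ₂, h₂⟩ := mem_coboundaries_succ_iff.1 hV
  have hχ : ψ₁ - ψ₂ ∈ cocycles w (inSet (U ∩ V)) n := mem_cocycles_iff.2 fun σ hσ => by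
    rw [LinearMap.sub_apply, ← h₁ σ fun t => (hσ t).1, ← h₂ σ fun t => (hσ t).2, sub_self]
  refine ⟨ψ₁ - ψ₂, hχ, mem_coboundaries_succ_iff.2
    ⟨ψ₁ - (ψ₁ - ψ₂) ∘ₗ proj (inSet V n), ?_⟩⟩
  rintro σ (hσ | hσ)
  · rw [LinearMap.sub_apply, connecting_of_mem_left _ hσ, h₁ σ hσ]
    rfl
  · rw [LinearMap.sub_apply, connecting_of_mem_right hχ hσ, h₂ σ hσ, LinearMap.sub_apply,
      LinearMap.comp_apply, proj_eq_self (bd_mem_supp w (Finsupp.single_mem_supported ℤ 1 hσ)),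
      LinearMap.sub_apply]
    ring

theorem connecting_eq_zero {χ : Cochain X n} (hχ : χ ∈ (supp (inSet (U ∩ V) n)).dualAnnihilator) :
    connecting w U V n χ = 0 :=
  LinearMap.ext fun c => (Submodule.mem_dualAnnihilator _).1 hχ _
    (proj_mem_supp_inter (bd_mem_supp w (proj_mem_supp _ c)))

theorem connecting_coboundary_mem (μ : Cochain X n) :
    connecting w U V (n + 1) (coboundary w n μ) ∈ coboundaries w (small U V) (n + 2) := by
  refine mem_coboundaries_succ_iff.2 ⟨(coboundary w n μ ∘ₗ proj (inSet V (n + 1)) -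
    μ ∘ₗ proj (inSet V n) ∘ₗ bd w n) ∘ₗ proj (inSet U (n + 1)), ?_⟩
  rintro σ (hσ | hσ)
  · rw [connecting_of_mem_left _ hσ, LinearMap.comp_apply,
      proj_eq_self (bd_mem_supp w (Finsupp.single_mem_supported ℤ 1 hσ))]
    simp [bd_bd]
  · rw [connecting_of_mem_right (coboundary_mem_cocycles μ) hσ, LinearMap.comp_apply]
    have mem_inter := proj_mem_supp_inter (V := U)
      (bd_mem_supp w (Finsupp.single_mem_supported ℤ 1 hσ))
    have mem_right := Finsupp.supported_mono (inSet_mono Set.inter_subset_left _) mem_inter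
    simp only [LinearMap.sub_apply, LinearMap.comp_apply, coboundary_apply,
      proj_eq_self mem_right, proj_eq_self (bd_mem_supp w mem_right), sub_self]

theorem connecting_mem_coboundaries {χ : Cochain X n}
    (hχ : χ ∈ coboundaries w (inSet (U ∩ V)) n) :
    connecting w U V n χ ∈ coboundaries w (small U V) (n + 1) := by
  rcases n with _ | n
  · rw [connecting_eq_zero hχ]
    exact zero_mem _
  · obtain ⟨_, ⟨μ, rfl⟩, ζ, hζ, rfl⟩ := Submodule.mem_sup.1 hχ
    rw [map_add, connecting_eq_zero hζ, add_zero]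
    exact connecting_coboundary_mem μ

end Connecting

/-! ### Bounds on cohomology -/

theorem fg_map_of_fg_map {R M N P : Type*} [Ring R] [AddCommGroup M] [Module R M]
    [AddCommGroup N] [Module R N] [AddCommGroup P] [Module R P] {Z : Submodule R M}
    {f : M →ₗ[R] N} {g : M →ₗ[R] P} (hf : (Z.map f).FG)
    (hg : ((Z ⊓ LinearMap.ker f).map g).FG) : (Z.map g).FG := by
  suffices h : (Z.map (f.prod g)).FG by
    simpa [← Submodule.map_comp] using h.map (LinearMap.snd R N P)
  refine Submodule.fg_of_fg_map_of_fg_inf_ker (LinearMap.fst R N P)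
    (by simpa [← Submodule.map_comp] using hf) ?_
  have ker_fst : Z.map (f.prod g) ⊓ LinearMap.ker (LinearMap.fst R N P) =
      ((Z ⊓ LinearMap.ker f).map g).map (LinearMap.inr R N P) := by
    ext ⟨a, b⟩
    simp only [Submodule.mem_inf, Submodule.mem_map, LinearMap.mem_ker, LinearMap.prod_apply,
      Function.prod_apply, LinearMap.fst_apply, LinearMap.inr_apply, Prod.mk.injEq]
    grind
  rw [ker_fst]
  exact hg.map _

theorem fg_map_of_inf_ker_le {R M N P : Type*} [Ring R] [AddCommGroup M] [Module R M]
    [AddCommGroup N] [Module R N] [AddCommGroup P] [Module R P] {Z : Submodule R M}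
    {f : M →ₗ[R] N} {g : M →ₗ[R] P} (hf : (Z.map f).FG)
    (hfg : Z ⊓ LinearMap.ker f ≤ LinearMap.ker g) : (Z.map g).FG :=
  fg_map_of_fg_map hf (by rw [LinearMap.le_ker_iff_map.1 hfg]; exact Submodule.fg_bot)

/-- The twisted cohomology in degree `n` of a family of simplices. -/
def cohomology (w : Twist X) (S : ∀ n, Set C(Simplex n, X)) (n : ℕ) :
    Submodule ℤ (Cochain X n ⧸ coboundaries w S n) :=
  (cocycles w S n).map (coboundaries w S n).mkQ

/-- The twisted cohomology of `A` is finitely generated in each degree and vanishes in degrees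
at least `d`. -/
structure CohomologyBound (w : Twist X) (A : Set X) (d : ℕ) : Prop where
  fg (n : ℕ) : (cohomology w (inSet A) n).FG
  vanish (n : ℕ) : d ≤ n → cocycles w (inSet A) n ≤ coboundaries w (inSet A) n

section CohomologyBound

variable {w : Twist X} {n d : ℕ} {A B U V : Set X}

theorem dualAnnihilator_le_coboundaries (S : ∀ n, Set C(Simplex n, X)) (n : ℕ) :
    (supp (S n)).dualAnnihilator ≤ coboundaries w S n := by
  cases n
  exacts [le_rfl, le_sup_right]

theorem fg_map_cocycles_of_subset (h : (cohomology w (inSet B) n).FG) (hBA : B ⊆ A) :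
    ((cocycles w (inSet A) n).map (coboundaries w (inSet B) n).mkQ).FG :=
  h.of_le (Submodule.map_mono (cocycles_anti (inSet_mono hBA (n + 1))))

theorem IsRelOpenCover.left_subset (h : IsRelOpenCover A U V) : U ⊆ A := by
  obtain ⟨O, -, rfl⟩ := h.left
  exact Set.inter_subset_left

theorem IsRelOpenCover.right_subset (h : IsRelOpenCover A U V) : V ⊆ A := by
  obtain ⟨O, -, rfl⟩ := h.right
  exact Set.inter_subset_left

theorem fg_map_connecting (h : (cohomology w (inSet (U ∩ V)) n).FG) :
    ((cocycles w (inSet (U ∩ V)) n).map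
      ((coboundaries w (small U V) (n + 1)).mkQ ∘ₗ connecting w U V n)).FG := by
  refine fg_map_of_inf_ker_le h fun χ hχ => ?_
  have hχ' : χ ∈ coboundaries w (inSet (U ∩ V)) n := by simpa using hχ.2
  simpa using connecting_mem_coboundaries hχ'

theorem fg_map_of_mem_coboundaries {Z : Submodule ℤ (Cochain X n)}
    (hU : ∀ φ ∈ Z, φ ∈ coboundaries w (inSet U) n) (hV : ∀ φ ∈ Z, φ ∈ coboundaries w (inSet V) n)
    (hUV : ∀ m, (cohomology w (inSet (U ∩ V)) m).FG) :
    (Z.map (coboundaries w (small U V) n).mkQ).FG := by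
  rcases n with _ | n
  · have hsmall : Z ≤ LinearMap.ker (coboundaries w (small U V) 0).mkQ := fun φ hφ => by
      rw [Submodule.ker_mkQ]
      exact mem_dualAnnihilator_supp.2 fun σ hσ => hσ.elim
        (mem_dualAnnihilator_supp.1 (hU φ hφ) σ) (mem_dualAnnihilator_supp.1 (hV φ hφ) σ)
    rw [LinearMap.le_ker_iff_map.1 hsmall]
    exact Submodule.fg_bot
  · refine (fg_map_connecting (hUV n)).of_le ?_
    rintro _ ⟨φ, hφ, rfl⟩
    obtain ⟨χ, hχ, hφχ⟩ := exists_sub_connecting_mem (hU φ hφ) (hV φ hφ)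
    exact ⟨χ, hχ, ((Submodule.Quotient.eq _).2 hφχ).symm⟩

/-- The Mayer-Vietoris sequence: a class on `A` is determined, up to finitely many generators, by
its restrictions to `U` and `V`, the kernel of the restriction being the image of the connecting
map. -/
theorem fg_cohomology_of_isRelOpenCover (hA : IsRelOpenCover A U V)
    (hU : (cohomology w (inSet U) n).FG) (hV : (cohomology w (inSet V) n).FG)
    (hUV : ∀ m, (cohomology w (inSet (U ∩ V)) m).FG) : (cohomology w (inSet A) n).FG := by
  refine fg_map_of_inf_ker_le (f := (coboundaries w (small U V) n).mkQ) ?_ (by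
    simpa only [Submodule.ker_mkQ] using cocycles_inf_coboundaries_small_le hA n)
  refine fg_map_of_fg_map
    (f := (coboundaries w (inSet U) n).mkQ.prod (coboundaries w (inSet V) n).mkQ) ?_ ?_
  · refine ((fg_map_cocycles_of_subset hU hA.left_subset).prod
      (fg_map_cocycles_of_subset hV hA.right_subset)).of_le ?_
    rintro _ ⟨φ, hφ, rfl⟩
    exact ⟨Submodule.mem_map_of_mem hφ, Submodule.mem_map_of_mem hφ⟩
  · rw [LinearMap.ker_prod, Submodule.ker_mkQ, Submodule.ker_mkQ]
    exact fg_map_of_mem_coboundaries (fun _ h => h.2.1) (fun _ h => h.2.2) hUV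

theorem cocycles_le_coboundaries_of_isRelOpenCover (hA : IsRelOpenCover A U V)
    (hU : cocycles w (inSet U) (n + 1) ≤ coboundaries w (inSet U) (n + 1))
    (hV : cocycles w (inSet V) (n + 1) ≤ coboundaries w (inSet V) (n + 1))
    (hUV : cocycles w (inSet (U ∩ V)) n ≤ coboundaries w (inSet (U ∩ V)) n) :
    cocycles w (inSet A) (n + 1) ≤ coboundaries w (inSet A) (n + 1) := by
  intro φ hφ
  refine cocycles_inf_coboundaries_small_le hA _ ⟨hφ, ?_⟩
  obtain ⟨χ, hχ, hφχ⟩ := exists_sub_connecting_mem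
    (hU (cocycles_anti (inSet_mono hA.left_subset _) hφ))
    (hV (cocycles_anti (inSet_mono hA.right_subset _) hφ))
  simpa using add_mem hφχ (connecting_mem_coboundaries (hUV hχ))

theorem inSet_singleton (c : X) (n : ℕ) : inSet {c} n = {ContinuousMap.const _ c} :=
  Set.ext fun _ => ⟨fun h => ContinuousMap.ext h, by rintro rfl; exact fun _ => rfl⟩

theorem bd_const (w : Twist X) (c : X) (n : ℕ) :
    bd w n (Chain.of (ContinuousMap.const _ c)) =
      (if Even n then 0 else 1 : ℤ) • Chain.of (ContinuousMap.const _ c) := by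
  have sign_eq_one (t : Simplex (n + 1)) : w.seg (ContinuousMap.const _ c) (vert 0) t = 1 :=
    w.seg_self (ContinuousMap.const (Simplex (n + 1)) c) (vert 0)
  have hsum := Fin.sum_neg_one_pow ℤ (n + 2)
  simp only [Nat.even_add, even_two, iff_true] at hsum
  simp only [bd_of, sign_eq_one, Units.val_one, mul_one, ← hsum, Finset.sum_smul]
  rfl

namespace CohomologyBound

theorem mono (h : CohomologyBound w A d) {d' : ℕ} (hd : d ≤ d') : CohomologyBound w A d' :=
  ⟨h.fg, fun n hn => h.vanish n (hd.trans hn)⟩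

theorem of_isDeformation (h : CohomologyBound w B d) (hBA : B ⊆ A) {F : C(A × unitInterval, X)}
    (hF : IsDeformation F B) : CohomologyBound w A d where
  fg n := fg_map_of_inf_ker_le (fg_map_cocycles_of_subset (h.fg n) hBA)
    (by simpa only [Submodule.ker_mkQ] using hF.cocycles_inf_coboundaries_le n)
  vanish n hn := (le_inf le_rfl ((cocycles_anti (inSet_mono hBA _)).trans (h.vanish n hn))).trans
    (hF.cocycles_inf_coboundaries_le n)

theorem mayerVietoris (hA : IsRelOpenCover A U V) (hU : CohomologyBound w U (d + 1))
    (hV : CohomologyBound w V (d + 1)) (hUV : CohomologyBound w (U ∩ V) d) :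
    CohomologyBound w A (d + 1) where
  fg n := fg_cohomology_of_isRelOpenCover hA (hU.fg n) (hV.fg n) hUV.fg
  vanish
    | n + 1, hn => cocycles_le_coboundaries_of_isRelOpenCover hA (hU.vanish _ hn) (hV.vanish _ hn)
        (hUV.vanish n (Nat.le_of_succ_le_succ hn))

theorem empty : CohomologyBound w (∅ : Set X) 0 := by
  have vanish (n : ℕ) : cocycles w (inSet (∅ : Set X)) n ≤ coboundaries w (inSet (∅ : Set X)) n :=
    fun φ _ => dualAnnihilator_le_coboundaries _ n
      (mem_dualAnnihilator_supp.2 fun σ hσ => (hσ (vert 0)).elim)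
  refine ⟨fun n => ?_, fun n _ => vanish n⟩
  rw [cohomology, LinearMap.le_ker_iff_map.1 ((vanish n).trans_eq (Submodule.ker_mkQ _).symm)]
  exact Submodule.fg_bot

theorem singleton (c : X) : CohomologyBound w {c} 1 where
  fg n := by
    refine fg_map_of_inf_ker_le (f := Module.Dual.eval ℤ (Chain X n)
      (Chain.of (ContinuousMap.const _ c))) (IsNoetherian.noetherian _) fun φ hφ => ?_
    rw [Submodule.ker_mkQ]
    refine dualAnnihilator_le_coboundaries _ n (mem_dualAnnihilator_supp.2 ?_)
    rw [inSet_singleton]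
    rintro _ rfl
    exact hφ.2
  vanish
    | n + 1, _ => fun φ hφ => by
      simp only [mem_cocycles_iff, mem_coboundaries_succ_iff, inSet_singleton,
        Set.mem_singleton_iff, forall_eq, bd_const, map_smul] at hφ ⊢
      refine ⟨Finsupp.linearCombination ℤ fun _ => φ (Chain.of (ContinuousMap.const _ c)), ?_⟩
      by_cases hn : Even n
      · simpa [hn, Nat.even_add_one] using hφ
      · simp [hn]

end CohomologyBound

end CohomologyBound

/-! ### Subsets of a chart -/

section Chart

variable {E : Type*} [TopologicalSpace E] {e : PartialEquiv E X}

theorem exists_isOpen_image_inter (hs : ContinuousOn e.symm e.target) {Q O : Set E}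
    (hQ : Q ⊆ e.source) (hO : IsOpen O) : ∃ O', IsOpen O' ∧ e '' (Q ∩ O) = e '' Q ∩ O' := by
  obtain ⟨O', hO', h⟩ := continuousOn_iff'.1 hs O hO
  have mem_iff {y : E} (hy : y ∈ Q) : e y ∈ O' ↔ y ∈ O := by
    simpa [e.map_source (hQ hy), e.left_inv (hQ hy)] using (Set.ext_iff.1 h (e y)).symm
  refine ⟨O', hO', ?_⟩
  rw [← Set.image_inter_preimage]
  exact congrArg _ (Set.ext fun y => and_congr_right fun hy => (mem_iff hy).symm)

variable {w : Twist X}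

namespace CohomologyBound

theorem image_inter_union (hs : ContinuousOn e.symm e.target) {Q O₁ O₂ : Set E} {d : ℕ}
    (hQ : Q ⊆ e.source) (hO₁ : IsOpen O₁) (hO₂ : IsOpen O₂)
    (h₁ : CohomologyBound w (e '' (Q ∩ O₁)) (d + 1))
    (h₂ : CohomologyBound w (e '' (Q ∩ O₂)) (d + 1))
    (h₁₂ : CohomologyBound w (e '' (Q ∩ O₂ ∩ O₁)) d) :
    CohomologyBound w (e '' (Q ∩ (O₁ ∪ O₂))) (d + 1) := by
  have hQ' {O : Set E} : Q ∩ O ⊆ e.source := Set.inter_subset_left.trans hQ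
  have restrict {O : Set E} (hO : O ⊆ O₁ ∪ O₂) : Q ∩ (O₁ ∪ O₂) ∩ O = Q ∩ O := by
    rw [Set.inter_assoc, Set.inter_eq_right.2 hO]
  have cover : IsRelOpenCover (e '' (Q ∩ (O₁ ∪ O₂))) (e '' (Q ∩ O₁)) (e '' (Q ∩ O₂)) := by
    constructor
    · rw [← restrict Set.subset_union_left]
      exact exists_isOpen_image_inter hs hQ' hO₁
    · rw [← restrict Set.subset_union_right]
      exact exists_isOpen_image_inter hs hQ' hO₂
    · rw [Set.inter_union_distrib_left, Set.image_union]
  refine mayerVietoris cover h₁ h₂ ?_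
  rwa [← e.injOn.image_inter hQ' hQ', ← Set.inter_inter_distrib_left, Set.inter_comm O₁,
    ← Set.inter_assoc]

variable [AddCommGroup E] [Module ℝ E] [IsTopologicalAddGroup E] [ContinuousSMul ℝ E]

theorem image_of_convex (he : ContinuousOn e e.source) (hs : ContinuousOn e.symm e.target)
    {Q : Set E} (hQ : Q ⊆ e.source) (hconv : Convex ℝ Q) : CohomologyBound w (e '' Q) 1 := by
  obtain rfl | ⟨q, hq⟩ := Q.eq_empty_or_nonempty
  · rw [Set.image_empty]
    exact empty.mono zero_le_one
  have symm_mem (a : e '' Q) : e.symm a ∈ Q := by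
    obtain ⟨_, y, hy, rfl⟩ := a
    rwa [e.left_inv (hQ hy)]
  have lineMap_mem (p : (e '' Q) × unitInterval) :
      AffineMap.lineMap (e.symm p.1) q (p.2 : ℝ) ∈ Q :=
    hconv.lineMap_mem (symm_mem p.1) hq p.2.2
  have symm_cont : Continuous fun a : e '' Q => e.symm a :=
    hs.comp_continuous continuous_subtype_val fun a => by
      obtain ⟨_, y, hy, rfl⟩ := a
      exact e.map_source (hQ hy)
  have contraction_cont : Continuous fun p : (e '' Q) × unitInterval =>
      e (AffineMap.lineMap (e.symm p.1) q (p.2 : ℝ)) := by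
    refine he.comp_continuous ?_ fun p => hQ (lineMap_mem p)
    simp only [AffineMap.lineMap_apply_module]
    have symm_fst := symm_cont.comp (continuous_fst (Y := unitInterval))
    simp only [Function.comp_def] at symm_fst
    fun_prop
  refine (singleton (e q)).of_isDeformation (F := ⟨_, contraction_cont⟩)
    (Set.singleton_subset_iff.2 (Set.mem_image_of_mem e hq))
    ⟨fun p => Set.mem_image_of_mem e (lineMap_mem p), fun a => ?_, fun a => ?_⟩
  · obtain ⟨_, y, hy, rfl⟩ := a
    simp [e.left_inv (hQ hy)]
  · simp

/-- Adjoining one functional `f i` to `s` adds the two convex pieces where `f i` is positive and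
where it is negative; each meets the previous set in a set of the same kind. -/
theorem image_inter_exists_ne_zero (he : ContinuousOn e e.source)
    (hs : ContinuousOn e.symm e.target) {ι : Type*} (f : ι → E →L[ℝ] ℝ) (s : Finset ι) {Q : Set E}
    (hQ : Q ⊆ e.source) (hconv : Convex ℝ Q) :
    CohomologyBound w (e '' (Q ∩ {y | ∃ i ∈ s, f i y ≠ 0})) s.card := by
  classical
  induction s using Finset.induction_on generalizing Q with
  | empty => simpa using empty
  | insert i s hi ih =>
    set D := {y | ∃ i ∈ s, f i y ≠ 0}
    have hD : IsOpen D := by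
      have : D = ⋃ i ∈ s, {y | f i y ≠ 0} := by
        ext
        simp [D]
      rw [this]
      exact isOpen_biUnion fun i _ => isOpen_ne_fun (f i).continuous continuous_const
    have hpos : IsOpen {y | 0 < f i y} := isOpen_lt continuous_const (f i).continuous
    have hneg : IsOpen {y | f i y < 0} := isOpen_lt (f i).continuous continuous_const
    have conv_pos := hconv.inter (convex_halfSpace_gt (f i).isLinear 0)
    have conv_neg := hconv.inter (convex_halfSpace_lt (f i).isLinear 0)
    have hQ' {O : Set E} : Q ∩ O ⊆ e.source := Set.inter_subset_left.trans hQ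
    have locus : {y | ∃ j ∈ insert i s, f j y ≠ 0} = D ∪ {y | 0 < f i y} ∪ {y | f i y < 0} := by
      ext y
      simp only [D, Finset.exists_mem_insert, ne_iff_lt_or_gt, Set.mem_union, Set.mem_ofPred_eq]
      grind
    have inter_neg : Q ∩ {y | f i y < 0} ∩ (D ∪ {y | 0 < f i y}) = Q ∩ {y | f i y < 0} ∩ D := by
      ext y
      simp only [Set.mem_inter_iff, Set.mem_union, Set.mem_ofPred_eq]
      grind
    rw [locus, Finset.card_insert_of_notMem hi]
    have one_le : 1 ≤ s.card + 1 := Nat.le_add_left 1 _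
    refine image_inter_union hs hQ (hD.union hpos) hneg ?_
      ((image_of_convex he hs hQ' conv_neg).mono one_le) (inter_neg ▸ ih hQ' conv_neg)
    exact image_inter_union hs hQ hD hpos ((ih hQ hconv).mono (Nat.le_succ _))
      ((image_of_convex he hs hQ' conv_pos).mono one_le) (ih hQ' conv_pos)

end CohomologyBound

theorem CohomologyBound.image_punctured {n : ℕ} {e : PartialEquiv (Fin n → ℝ) X}
    (he : ContinuousOn e e.source) (hs : ContinuousOn e.symm e.target)
    (hconv : Convex ℝ e.source) : CohomologyBound w (e '' (e.source \ {0})) n := by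
  have h := image_inter_exists_ne_zero (w := w) he hs
    (ContinuousLinearMap.proj (R := ℝ) (φ := fun _ : Fin n => ℝ)) Finset.univ subset_rfl hconv
  have locus : e.source ∩ {y | ∃ i ∈ Finset.univ,
      ContinuousLinearMap.proj (R := ℝ) (φ := fun _ : Fin n => ℝ) i y ≠ 0} = e.source \ {0} := by
    ext y
    simp [funext_iff]
  rwa [locus, Finset.card_univ, Fintype.card_fin] at h

end Chart

/-! ### Attaching a cell -/

theorem continuous_of_continuousOn_of_isClosedMap {T Y Z : Type*} [TopologicalSpace T]
    [TopologicalSpace Y] [TopologicalSpace Z] {F : Y → Z} {C : Set Y} {P : T → Y} (hC : IsClosed C)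
    (hFC : ContinuousOn F C) (hP : IsClosedMap P) (hFP : Continuous (F ∘ P))
    (hcover : ∀ y, y ∈ C ∨ y ∈ Set.range P) : Continuous F := by
  refine continuous_iff_isClosed.2 fun Z hZ => ?_
  have preimage_eq : F ⁻¹' Z = C ∩ F ⁻¹' Z ∪ P '' ((F ∘ P) ⁻¹' Z) := by
    rw [Set.preimage_comp, Set.image_preimage_eq_inter_range, Set.inter_comm C,
      ← Set.inter_union_distrib_left]
    exact (Set.inter_eq_left.2 fun y _ => hcover y).symm
  rw [preimage_eq]
  exact (hFC.preimage_isClosed_of_isClosed hC hZ).union (hP _ (hZ.preimage hFP))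

section CellAttachment

variable {V : Type*} [NormedAddCommGroup V] {E : Set X} {e : PartialEquiv V X}

/-- The closed set `E` is to be enlarged by the open cell with characteristic map `e`, whose
boundary sphere is mapped into `E`. -/
structure CellAttachment (E : Set X) (e : PartialEquiv V X) : Prop where
  isClosed : IsClosed E
  source_eq : e.source = Metric.ball 0 1
  continuousOn : ContinuousOn e (Metric.closedBall 0 1)
  continuousOn_symm : ContinuousOn e.symm e.target
  image_sphere_subset : e '' Metric.sphere 0 1 ⊆ E
  disjoint : Disjoint (e '' Metric.ball 0 1) E

namespace CellAttachment

variable (h : CellAttachment E e)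

include h

theorem apply_notMem {y : V} (hy : y ∈ Metric.ball 0 1) : e y ∉ E :=
  Set.disjoint_left.1 h.disjoint (Set.mem_image_of_mem e hy)

theorem apply_mem_of_norm_eq_one {y : V} (hy : ‖y‖ = 1) : e y ∈ E :=
  h.image_sphere_subset (Set.mem_image_of_mem e (mem_sphere_zero_iff_norm.2 hy))

theorem center_notMem_punctured : e 0 ∉ E ∪ e '' (Metric.closedBall 0 1 \ {0}) := by
  have center_mem : (0 : V) ∈ Metric.ball 0 1 := Metric.mem_ball_self one_pos
  rintro (h₀ | ⟨y, ⟨hy, hy₀⟩, hye⟩)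
  · exact h.apply_notMem center_mem h₀
  · rcases (mem_closedBall_zero_iff.1 hy).lt_or_eq with hlt | heq
    · exact hy₀ (e.injOn (h.source_eq ▸ mem_ball_zero_iff.2 hlt) (h.source_eq ▸ center_mem) hye)
    · exact h.apply_notMem center_mem (hye ▸ h.apply_mem_of_norm_eq_one heq)

theorem punctured_eq :
    E ∪ e '' (Metric.closedBall 0 1 \ {0}) = (E ∪ e '' Metric.ball 0 1) \ {e 0} := by
  refine subset_antisymm ?_ ?_
  · refine fun x hx => ⟨?_, ne_of_mem_of_not_mem hx h.center_notMem_punctured⟩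
    obtain hx | ⟨y, ⟨hy, -⟩, rfl⟩ := hx
    · exact .inl hx
    · rcases (mem_closedBall_zero_iff.1 hy).lt_or_eq with hlt | heq
      · exact .inr (Set.mem_image_of_mem e (mem_ball_zero_iff.2 hlt))
      · exact .inl (h.apply_mem_of_norm_eq_one heq)
  · rintro x ⟨hx | ⟨y, hy, rfl⟩, hne⟩
    · exact .inl hx
    · exact .inr ⟨y, ⟨Metric.ball_subset_closedBall hy, ne_of_apply_ne e hne⟩, rfl⟩

theorem isRelOpenCover [T1Space X] : IsRelOpenCover (E ∪ e '' Metric.ball 0 1)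
    (E ∪ e '' (Metric.closedBall 0 1 \ {0})) (e '' Metric.ball 0 1) where
  left := ⟨{e 0}ᶜ, isOpen_compl_singleton, h.punctured_eq⟩
  right := by
    refine ⟨Eᶜ, h.isClosed.isOpen_compl, ?_⟩
    rw [← Set.sdiff_eq, Set.union_sdiff_left, h.disjoint.sdiff_eq_left]
  subset x hx := by
    rw [h.punctured_eq]
    by_cases hxe : x = e 0
    · exact .inr (hxe ▸ Set.mem_image_of_mem e (Metric.mem_ball_self one_pos))
    · exact .inl ⟨hx, hxe⟩

theorem punctured_inter_image_ball :
    (E ∪ e '' (Metric.closedBall 0 1 \ {0})) ∩ e '' Metric.ball 0 1 =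
      e '' (Metric.ball 0 1 \ {0}) := by
  have hinj : Set.InjOn e (Metric.ball 0 1) := h.source_eq ▸ e.injOn
  rw [h.punctured_eq, hinj.image_sdiff_subset
    (Set.singleton_subset_iff.2 (Metric.mem_ball_self one_pos)), Set.image_singleton,
    Set.inter_comm, ← Set.inter_sdiff_assoc, Set.inter_eq_left.2 Set.subset_union_right]

end CellAttachment

variable [NormedSpace ℝ V]

/-- The point at time `t` of the radial segment from `y` to the unit sphere; the junk value at
`y = 0` is `0`. -/
def radialPush (y : V) (t : ℝ) : V := (1 - t + t * ‖y‖⁻¹) • y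

@[simp]
theorem radialPush_zero (y : V) : radialPush y 0 = y := by
  simp [radialPush]

theorem radialPush_of_norm_eq_one {y : V} (hy : ‖y‖ = 1) (t : ℝ) : radialPush y t = y := by
  simp [radialPush, hy]

theorem norm_radialPush {y : V} {t : ℝ} (hy : y ≠ 0) (ht : t ∈ unitInterval) :
    ‖radialPush y t‖ = (1 - t) * ‖y‖ + t := by
  have := norm_pos_iff.2 hy
  have h₁ : 0 ≤ 1 - t := sub_nonneg.2 ht.2
  have h₂ : 0 ≤ t := ht.1
  rw [radialPush, norm_smul, Real.norm_of_nonneg (by positivity)]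
  field_simp

theorem radialPush_mem_closedBall {y : V} {t : ℝ} (hy : y ∈ Metric.closedBall 0 1 \ {0})
    (ht : t ∈ unitInterval) :
    radialPush y t ∈ Metric.closedBall (0 : V) 1 \ {0} := by
  obtain ⟨hle, hy⟩ := hy
  have hpos : 0 < ‖y‖ := norm_pos_iff.2 hy
  rw [mem_closedBall_zero_iff] at hle
  rw [Set.mem_sdiff, mem_closedBall_zero_iff, Set.mem_singleton_iff, ← norm_eq_zero,
    norm_radialPush hy ht]
  constructor <;> nlinarith [ht.1, ht.2]

theorem continuous_radialPush {T : Type*} [TopologicalSpace T] {f : T → V} {g : T → ℝ}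
    (hf : Continuous f) (hg : Continuous g) (hf₀ : ∀ x, f x ≠ 0) :
    Continuous fun x => radialPush (f x) (g x) :=
  ((continuous_const.sub hg).add (hg.mul (hf.norm.inv₀ fun x => norm_ne_zero_iff.2 (hf₀ x)))).smul
    hf

/-- The deformation of a set with a cell attached and the centre of the cell removed: points of
the cell are pushed radially to its boundary. -/
def pushOff (E : Set X) (e : PartialEquiv V X) (x : X) (t : ℝ) : X :=
  open Classical in if x ∈ E then x else e (radialPush (e.symm x) t)

namespace CellAttachment

theorem pushOff_apply (h : CellAttachment E e) {y : V} (hy : y ∈ Metric.closedBall 0 1) (t : ℝ) :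
    pushOff E e (e y) t = e (radialPush y t) := by
  rcases (mem_closedBall_zero_iff.1 hy).lt_or_eq with hlt | heq
  · have hb := mem_ball_zero_iff.2 hlt
    rw [pushOff, if_neg (h.apply_notMem hb), e.left_inv (h.source_eq ▸ hb)]
  · rw [pushOff, if_pos (h.apply_mem_of_norm_eq_one heq), radialPush_of_norm_eq_one heq]

/-- The closed ball without its centre maps properly to the domain, so continuity can be checked
after pulling back along this map and on `E`. -/
theorem continuous_pushOff [T2Space X] [ProperSpace V] (h : CellAttachment E e) :
    Continuous fun p : ↥(E ∪ e '' (Metric.closedBall 0 1 \ {0})) × unitInterval =>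
      pushOff E e p.1 p.2 := by
  set A := E ∪ e '' (Metric.closedBall 0 1 \ {0})
  let q (y : Metric.closedBall (0 : V) 1) : X := e y
  have hq : Continuous q := h.continuousOn.comp_continuous continuous_subtype_val fun y => y.2
  let P : (q ⁻¹' A) × unitInterval → A × unitInterval := Prod.map (A.restrictPreimage q) id
  have hP : IsClosedMap P :=
    ((hq.isProperMap.restrictPreimage A).prodMap isProperMap_id).isClosedMap
  have ne_zero (y : q ⁻¹' A) : y.1.1 ≠ 0 :=
    ne_of_apply_ne e (ne_of_mem_of_not_mem y.2 h.center_notMem_punctured)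
  have pushOff_comp (p) : pushOff E e (P p).1 (P p).2 = e (radialPush p.1.1.1 p.2) :=
    h.pushOff_apply p.1.1.2 _
  refine continuous_of_continuousOn_of_isClosedMap (P := P) (C := {p | p.1.1 ∈ E})
    (h.isClosed.preimage (by fun_prop)) ?_ hP ?_ ?_
  · have hfst : Continuous fun p : A × unitInterval => p.1.1 := by fun_prop
    exact hfst.continuousOn.congr fun p hp => if_pos hp
  · refine Continuous.congr ?_ fun p => (pushOff_comp p).symm
    exact h.continuousOn.comp_continuous
      (continuous_radialPush (by fun_prop) (by fun_prop) fun p => ne_zero p.1)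
      fun p => (radialPush_mem_closedBall ⟨p.1.1.2, ne_zero p.1⟩ p.2.2).1
  · rintro ⟨⟨_, hx | ⟨y, hy, rfl⟩⟩, t⟩
    · exact .inl hx
    · exact .inr ⟨(⟨⟨y, hy.1⟩, .inr ⟨y, hy, rfl⟩⟩, t), rfl⟩

theorem isDeformation [T2Space X] [ProperSpace V] (h : CellAttachment E e) :
    IsDeformation ⟨_, h.continuous_pushOff⟩ E where
  mem := by
    rintro ⟨⟨_, hx | ⟨y, hy, rfl⟩⟩, t⟩
    · simp [pushOff, hx]
    · exact .inr ⟨_, radialPush_mem_closedBall hy t.2, (h.pushOff_apply hy.1 t).symm⟩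
  start := by
    rintro ⟨_, hx | ⟨y, hy, rfl⟩⟩
    · simp [pushOff, hx]
    · simp [h.pushOff_apply hy.1]
  finish := by
    rintro ⟨_, hx | ⟨y, hy, rfl⟩⟩
    · simp [pushOff, hx]
    · have hnorm : ‖radialPush y 1‖ = 1 := by simp [norm_radialPush hy.2]
      simpa [h.pushOff_apply hy.1] using h.apply_mem_of_norm_eq_one hnorm

end CellAttachment

theorem CohomologyBound.attachCell [T2Space X] {w : Twist X} {n d : ℕ}
    {e : PartialEquiv (Fin n → ℝ) X} (h : CellAttachment E e) (hE : CohomologyBound w E (d + 1))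
    (hn : n ≤ d) : CohomologyBound w (E ∪ e '' Metric.ball 0 1) (d + 1) := by
  have he : ContinuousOn e e.source :=
    h.continuousOn.mono (h.source_eq ▸ Metric.ball_subset_closedBall)
  have hconv : Convex ℝ e.source := h.source_eq ▸ convex_ball 0 1
  have cell := image_of_convex (w := w) he h.continuousOn_symm subset_rfl hconv
  have punctured_cell := image_punctured (w := w) he h.continuousOn_symm hconv
  rw [h.source_eq] at cell punctured_cell
  refine mayerVietoris h.isRelOpenCover (hE.of_isDeformation Set.subset_union_left h.isDeformation)
    (cell.mono (Nat.le_add_left 1 d)) ?_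
  rw [h.punctured_inter_image_ball]
  exact punctured_cell.mono hn

end CellAttachment

/-! ### Finite complexes -/

section FiniteComplex

open RelCWComplex

variable {C : Set X} [CWComplex C] {J : Finset (Σ n, cell C n)} {i j : Σ n, cell C n}

/-- The union of finitely many open cells. -/
def cellUnion (J : Finset (Σ n, cell C n)) : Set X :=
  ⋃ i ∈ J, openCell i.1 i.2

/-- A finite family of cells that contains, with each cell, the cells meeting its boundary: the
cells of a finite subcomplex. -/
def IsClosedFamily (J : Finset (Σ n, cell C n)) : Prop :=
  ∀ i ∈ J, cellFrontier i.1 i.2 ⊆ cellUnion J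

theorem openCell_subset_cellUnion (hi : i ∈ J) : openCell i.1 i.2 ⊆ cellUnion J :=
  Set.subset_biUnion_of_mem (u := fun i : Σ n, cell C n => openCell i.1 i.2) hi

theorem cellUnion_erase_union_openCell [DecidableEq (Σ n, cell C n)] (hj : j ∈ J) :
    cellUnion (J.erase j) ∪ openCell j.1 j.2 = cellUnion J := by
  conv_rhs => rw [← Finset.insert_erase hj, cellUnion, Finset.set_biUnion_insert, Set.union_comm]
  rfl

theorem isPathConnected_closedCell (i : Σ n, cell C n) : IsPathConnected (closedCell i.1 i.2) :=
  ((convex_closedBall (0 : Fin i.1 → ℝ) 1).isPathConnected ⟨0, by simp⟩).image'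
    (continuousOn i.1 i.2)

theorem IsClosedFamily.isClosed_cellUnion [T2Space X] (hJ : IsClosedFamily J) :
    IsClosed (cellUnion J) := by
  have eq_closedCells : cellUnion J = ⋃ i ∈ J, closedCell i.1 i.2 := by
    refine subset_antisymm (Set.iUnion₂_mono fun i _ => openCell_subset_closedCell _ _)
      (Set.iUnion₂_subset fun i hi => ?_)
    rw [← cellFrontier_union_openCell_eq_closedCell]
    exact Set.union_subset (hJ i hi) (openCell_subset_cellUnion hi)
  rw [eq_closedCells]
  exact isClosed_biUnion_finset fun i _ => isClosed_closedCell

theorem disjoint_cellFrontier_openCell (h : i.1 ≤ j.1) :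
    Disjoint (cellFrontier i.1 i.2) (openCell j.1 j.2) := by
  refine Set.disjoint_left.2 fun x hx hxj => ?_
  obtain ⟨I, hI⟩ := CWComplex.cellFrontier_subset_finite_openCell i.1 i.2
  obtain ⟨m, hm, k, -, hk⟩ : ∃ m < i.1, ∃ k ∈ I m, x ∈ openCell m k := by simpa using hI hx
  refine Set.disjoint_left.1 (disjoint_openCell_of_ne (j := j.2) fun hkj => ?_) hk hxj
  exact (hm.trans_le h).ne (congrArg Sigma.fst hkj)

variable [DecidableEq (Σ n, cell C n)]

theorem disjoint_openCell_cellUnion_erase (j : Σ n, cell C n) (J : Finset (Σ n, cell C n)) :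
    Disjoint (openCell j.1 j.2) (cellUnion (J.erase j)) := by
  simp only [cellUnion, Set.disjoint_iUnion_right]
  exact fun i hi => disjoint_openCell_of_ne (Finset.ne_of_mem_erase hi).symm

namespace IsClosedFamily

variable (hJ : IsClosedFamily J) (hj : j ∈ J) (hmax : ∀ i ∈ J, i.1 ≤ j.1)

include hJ hj hmax

theorem cellFrontier_subset_erase (hi : i ∈ J) :
    cellFrontier i.1 i.2 ⊆ cellUnion (J.erase j) := by
  refine (disjoint_cellFrontier_openCell (hmax i hi)).subset_left_of_subset_union ?_
  rw [cellUnion_erase_union_openCell hj]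
  exact hJ i hi

theorem erase : IsClosedFamily (J.erase j) := fun _ hi =>
  hJ.cellFrontier_subset_erase hj hmax (Finset.mem_of_mem_erase hi)

theorem cellAttachment [T2Space X] : CellAttachment (cellUnion (J.erase j)) (map j.1 j.2) where
  isClosed := (hJ.erase hj hmax).isClosed_cellUnion
  source_eq := source_eq j.1 j.2
  continuousOn := continuousOn j.1 j.2
  continuousOn_symm := continuousOn_symm j.1 j.2
  image_sphere_subset := hJ.cellFrontier_subset_erase hj hmax hj
  disjoint := disjoint_openCell_cellUnion_erase j J

end IsClosedFamily

omit [DecidableEq (Σ n, cell C n)]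

variable [T2Space X] {w : Twist X} {d : ℕ}

theorem CohomologyBound.of_isClosedFamily (hdim : ∀ i ∈ J, i.1 ≤ d) (hJ : IsClosedFamily J) :
    CohomologyBound w (cellUnion J) (d + 1) := by
  classical
  induction J using Finset.strongInduction with
  | H J ih =>
    obtain rfl | hne := J.eq_empty_or_nonempty
    · simpa [cellUnion] using empty.mono (Nat.zero_le (d + 1))
    · obtain ⟨j, hj, hmax⟩ := J.exists_max_image Sigma.fst hne
      rw [← cellUnion_erase_union_openCell hj]
      refine attachCell (hJ.cellAttachment hj hmax) ?_ (hdim j hj)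
      exact ih _ (Finset.erase_ssubset hj) (fun i hi => hdim i (Finset.mem_of_mem_erase hi))
        (hJ.erase hj hmax)

theorem CohomologyBound.of_finite_complex [RelCWComplex.Finite C]
    (hdim : ∀ n, d < n → IsEmpty (cell C n)) : CohomologyBound w C (d + 1) := by
  have := finite_cells_of_finite (C := C)
  have := Fintype.ofFinite (Σ n, cell C n)
  have cellUnion_univ : cellUnion (Finset.univ : Finset (Σ n, cell C n)) = C := by
    refine Eq.trans ?_ (CWComplex.iUnion_openCell_eq_complex (C := C))
    simp [cellUnion, Set.iUnion_sigma]
  have closed : IsClosedFamily (Finset.univ : Finset (Σ n, cell C n)) := fun i _ => by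
    rw [cellUnion_univ]
    exact cellFrontier_subset_complex i.1 i.2
  have dim_le (i : Σ n, cell C n) : i.1 ≤ d := not_lt.1 fun h => (hdim i.1 h).false i.2
  exact cellUnion_univ ▸ of_isClosedFamily (fun i _ => dim_le i) closed

end FiniteComplex

section PathConnected

open RelCWComplex

variable [T2Space X] [CWComplex (Set.univ : Set X)] [RelCWComplex.Finite (Set.univ : Set X)]

theorem isClosed_of_pathComponent_subset {s : Set X} (hs : ∀ x ∈ s, pathComponent x ⊆ s) :
    IsClosed s := by
  have := finite_cells_of_finite (C := (Set.univ : Set X))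
  have eq_closedCells :
      s = ⋃ i ∈ {i : Σ n, cell (Set.univ : Set X) n | closedCell i.1 i.2 ⊆ s},
        closedCell i.1 i.2 := by
    refine subset_antisymm (fun x hx => ?_) (Set.iUnion₂_subset fun i hi => hi)
    obtain ⟨i, hi⟩ : ∃ i : Σ n, cell (Set.univ : Set X) n, x ∈ closedCell i.1 i.2 := by
      simpa [← CWComplex.union (C := (Set.univ : Set X))] using Set.mem_univ x
    exact Set.mem_biUnion (x := i)
      (((isPathConnected_closedCell i).subset_pathComponent hi).trans (hs x hx)) hi
  rw [eq_closedCells]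
  exact (Set.toFinite _).isClosed_biUnion fun i _ => isClosed_closedCell

theorem pathConnectedSpace_of_finite_complex [ConnectedSpace X] : PathConnectedSpace X := by
  obtain ⟨x₀⟩ := (inferInstance : Nonempty X)
  have hclosed : IsClosed (pathComponent x₀) :=
    isClosed_of_pathComponent_subset fun x hx => (pathComponent_congr hx).le
  have hclosed_compl : IsClosed (pathComponent x₀)ᶜ :=
    isClosed_of_pathComponent_subset fun x hx y hy hy' => hx (hy'.trans hy.symm)
  have hclopen : IsClopen (pathComponent x₀) := ⟨hclosed, isClosed_compl_iff.1 hclosed_compl⟩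
  exact pathConnectedSpace_iff_eq.2 ⟨x₀, hclopen.eq_univ (pathComponent.nonempty x₀)⟩

end PathConnected

/-! ### The twist of a homomorphism from the fundamental group -/

theorem dualAnnihilator_supp_univ (n : ℕ) :
    (supp (inSet (Set.univ : Set X) n)).dualAnnihilator = ⊥ :=
  eq_bot_iff.2 fun _ hφ =>
    hom_ext_single fun σ => mem_dualAnnihilator_supp.1 hφ σ fun _ => Set.mem_univ _

section Holonomy

variable {x₀ : X} (α : FundamentalGroup X x₀ →* ℤˣ) (γ : ∀ x, Path.Homotopic.Quotient x₀ x)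

/-- The sign of the transport along a path class, relative to the chosen classes `γ`. -/
def holonomy {x y : X} (δ : Path.Homotopic.Quotient x y) : ℤˣ :=
  α (FundamentalGroup.fromPath (((γ x).trans δ).trans (γ y).symm))

variable {α}

theorem fibre_apply {y : X} (f : LocalCoeff.fibre α y) {x : X}
    (δ : Path.Homotopic.Quotient x y) :
    f.1 ((γ x).trans δ) = (holonomy α γ δ : ℤ) * f.1 (γ y) := by
  have h := f.2 (FundamentalGroup.fromPath (((γ x).trans δ).trans (γ y).symm)) (γ y)
  rw [holonomy, ← h]
  simp [FundamentalGroup.toPath, FundamentalGroup.fromPath, Path.Homotopic.Quotient.trans_assoc]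

variable (α)

theorem holonomy_trans {x y z : X} (δ : Path.Homotopic.Quotient x y)
    (ε : Path.Homotopic.Quotient y z) :
    holonomy α γ (δ.trans ε) = holonomy α γ δ * holonomy α γ ε := by
  rw [mul_comm, holonomy, holonomy, holonomy, ← map_mul, FundamentalGroup.mul_def]
  have key (ζ : Path.Homotopic.Quotient y x₀) : (γ y).symm.trans ((γ y).trans ζ) = ζ := by
    rw [← Path.Homotopic.Quotient.trans_assoc, Path.Homotopic.Quotient.symm_trans,
      Path.Homotopic.Quotient.refl_trans]
  simp [FundamentalGroup.fromPath, Path.Homotopic.Quotient.trans_assoc, key]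

/-- The sign of the image under `G` of a path between two points of a simplex. -/
def simplexSign {n : ℕ} (G : C(Simplex n, X)) (y z : Simplex n) : ℤˣ :=
  holonomy α γ ((Path.Homotopic.Quotient.mk (segmentPath y z)).map G)

theorem simplexSign_mul {n : ℕ} (G : C(Simplex n, X)) (x y z : Simplex n) :
    simplexSign α γ G x y * simplexSign α γ G y z = simplexSign α γ G x z := by
  rw [simplexSign, simplexSign, simplexSign, ← holonomy_trans]
  congr 1
  rw [Subsingleton.elim (Path.Homotopic.Quotient.mk (segmentPath x z))
    ((Path.Homotopic.Quotient.mk (segmentPath x y)).trans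
      (Path.Homotopic.Quotient.mk (segmentPath y z)))]
  simp only [← Path.Homotopic.Quotient.mk_map, ← Path.Homotopic.Quotient.mk_trans]
  rw [Path.map_trans]

theorem simplexSign_comp {m n : ℕ} (G : C(Simplex n, X)) (f : C(Simplex m, Simplex n))
    (y z : Simplex m) :
    simplexSign α γ (G.comp f) y z = simplexSign α γ G (f y) (f z) := by
  rw [simplexSign, simplexSign, Subsingleton.elim
    (Path.Homotopic.Quotient.mk (segmentPath (f y) (f z)))
    ((Path.Homotopic.Quotient.mk (segmentPath y z)).map f)]
  rfl

theorem simplexMap_vert {m n : ℕ} (f : Fin (m + 1) → Fin (n + 1)) (i : Fin (m + 1)) :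
    simplexMap f (vert i) = vert (f i) :=
  stdSimplex.map_vertex f i

/-- The twist of a homomorphism from the fundamental group to `{1, -1}`. -/
def Twist.ofHom : Twist X where
  sign σ := simplexSign α γ σ (vert 0) (vert 1)
  cocycle σ := by
    simp only [simplexSign_comp, simplexMap_vert]
    exact simplexSign_mul α γ σ _ _ _

theorem Twist.ofHom_seg {n : ℕ} (σ : C(Simplex n, X)) (y z : Simplex n) :
    (Twist.ofHom α γ).seg σ y z = simplexSign α γ σ y z := by
  simp only [Twist.seg, Twist.ofHom, simplexSign_comp, lin_vert]
  rfl

/-! ### Comparison of the cochain complexes -/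

/-- Evaluation of the fibre of the local system at the chosen path class. -/
def fibreEquiv (x : X) : LocalCoeff.fibre α x ≃ₗ[ℤ] ℤ where
  toFun f := f.1 (γ x)
  map_add' _ _ := rfl
  map_smul' _ _ := rfl
  invFun a := ⟨fun δ => (α (FundamentalGroup.fromPath (δ.trans (γ x).symm)) : ℤ) * a,
    fun g δ => by
      rw [← mul_assoc, ← Units.val_mul, mul_comm (α g), ← map_mul, FundamentalGroup.mul_def]
      exact congrArg (fun p => (α (FundamentalGroup.fromPath p) : ℤ) * a)
        (Path.Homotopic.Quotient.trans_assoc g.toPath δ (γ x).symm)⟩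
  left_inv f := by
    ext δ
    have h := f.2 (FundamentalGroup.fromPath (δ.trans (γ x).symm)) (γ x)
    refine h.symm.trans ?_
    simp [FundamentalGroup.toPath, FundamentalGroup.fromPath, Path.Homotopic.Quotient.trans_assoc]
  right_inv a := by
    have : (α (FundamentalGroup.fromPath ((γ x).trans (γ x).symm)) : ℤ) = 1 := by
      rw [Path.Homotopic.Quotient.trans_symm]
      exact congrArg Units.val (map_one α)
    simp only [this, one_mul]

/-- Cochains with local coefficients as functionals on singular chains. -/
def cochainEquiv (n : ℕ) : LocalCoeff.Cochain α n ≃ₗ[ℤ] Cochain X n :=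
  (LinearEquiv.piCongrRight fun σ : C(Simplex n, X) => fibreEquiv α γ (σ (e₀ n))).trans
    (Finsupp.llift ℤ ℤ ℤ _)

variable {α} {n : ℕ}

theorem cochainEquiv_apply (φ : LocalCoeff.Cochain α n) (σ : C(Simplex n, X)) :
    cochainEquiv α γ n φ (Chain.of σ) = (φ σ).1 (γ (σ (e₀ n))) := by
  simp [cochainEquiv, fibreEquiv]

theorem cochainEquiv_coboundary (φ : LocalCoeff.Cochain α n) :
    cochainEquiv α γ (n + 1) (LocalCoeff.coboundary α n φ) =
      coboundary (Twist.ofHom α γ) n (cochainEquiv α γ n φ) := by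
  refine hom_ext_single fun σ => ?_
  rw [cochainEquiv_apply, coboundary_apply, bd_of, map_sum]
  have hsum : (LocalCoeff.coboundary α n φ σ).1 (γ (σ (e₀ (n + 1)))) = ∑ i : Fin (n + 2),
      (-1 : ℤ) ^ (i : ℕ) * (LocalCoeff.pull α i.succAbove φ σ).1 (γ (σ (e₀ (n + 1)))) := by
    simp [LocalCoeff.coboundary, LinearMap.sum_apply, Finset.sum_apply]
  rw [hsum]
  refine Finset.sum_congr rfl fun i _ => ?_
  rw [map_smul, cochainEquiv_apply, Twist.ofHom_seg, smul_eq_mul, mul_assoc, ← simplexMap_vert]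
  congr 1
  exact fibre_apply γ (φ (σ.comp (simplexMap i.succAbove))) _

theorem cochainEquiv_mem_cocycles_iff {φ : LocalCoeff.Cochain α n} :
    cochainEquiv α γ n φ ∈ cocycles (Twist.ofHom α γ) (inSet Set.univ) n ↔
      φ ∈ LinearMap.ker (LocalCoeff.coboundary α n) := by
  rw [cocycles, dualAnnihilator_supp_univ, Submodule.mem_comap, Submodule.mem_bot,
    ← cochainEquiv_coboundary, LinearEquiv.map_eq_zero_iff, LinearMap.mem_ker]

theorem cochainEquiv_mem_coboundaries_iff {φ : LocalCoeff.Cochain α n} :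
    cochainEquiv α γ n φ ∈ coboundaries (Twist.ofHom α γ) (inSet Set.univ) n ↔
      φ ∈ LocalCoeff.boundaries α n := by
  rcases n with _ | n
  · rw [coboundaries, dualAnnihilator_supp_univ, Submodule.mem_bot, LinearEquiv.map_eq_zero_iff]
    rfl
  · rw [coboundaries, dualAnnihilator_supp_univ, sup_bot_eq, LinearMap.mem_range,
      (cochainEquiv α γ n).surjective.exists]
    simp only [← cochainEquiv_coboundary, (cochainEquiv α γ (n + 1)).injective.eq_iff]
    rfl

theorem map_cochainEquiv_ker_coboundary :
    (LinearMap.ker (LocalCoeff.coboundary α n)).map (cochainEquiv α γ n).toLinearMap =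
      cocycles (Twist.ofHom α γ) (inSet Set.univ) n := by
  ext φ
  obtain ⟨φ, rfl⟩ := (cochainEquiv α γ n).surjective φ
  rw [cochainEquiv_mem_cocycles_iff]
  exact (cochainEquiv α γ n).injective.mem_set_image

variable (α) in
/-- The cohomology with local coefficients is the twisted cohomology of the whole space. -/
def cohomologyEquiv (n : ℕ) :
    LocalCoeff.Cohomology α n ≃ₗ[ℤ] cohomology (Twist.ofHom α γ) (inSet Set.univ) n :=
  let Z := LinearMap.ker (LocalCoeff.coboundary α n)
  let B := coboundaries (Twist.ofHom α γ) (inSet Set.univ) n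
  let f : Z →ₗ[ℤ] Cochain X n ⧸ B := B.mkQ ∘ₗ (cochainEquiv α γ n).toLinearMap ∘ₗ Z.subtype
  have ker_eq : (LocalCoeff.boundaries α n).submoduleOf Z = LinearMap.ker f := by
    ext z
    exact (cochainEquiv_mem_coboundaries_iff γ).symm.trans (Submodule.Quotient.mk_eq_zero B).symm
  have range_eq : LinearMap.range f = cohomology (Twist.ofHom α γ) (inSet Set.univ) n := by
    rw [cohomology, ← map_cochainEquiv_ker_coboundary, LinearMap.range_comp, LinearMap.range_comp,
      Submodule.range_subtype]
  (Submodule.quotEquivOfEq _ _ ker_eq).trans (f.quotKerEquivRange.trans (.ofEq _ _ range_eq))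

end Holonomy

/-! ### Divisibility by two -/

theorem finite_and_coprime_card_of_surjective_nsmul {A : Type*} [AddCommGroup A]
    [Module.Finite ℤ A] {n : ℕ} (hn : n ≠ 1) (h : Function.Surjective (n • · : A → A)) :
    Finite A ∧ (Nat.card A).Coprime n := by
  obtain ⟨r, hr, hr_smul⟩ := Submodule.exists_sub_one_mem_and_smul_eq_zero_of_fg_of_le_smul
    (Ideal.span {(n : ℤ)}) (⊤ : Submodule ℤ A) Module.Finite.fg_top fun x _ => by
      obtain ⟨y, rfl⟩ := h x
      change n • y ∈ _
      rw [← natCast_zsmul]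
      exact Submodule.smul_mem_smul (Ideal.mem_span_singleton_self _) Submodule.mem_top
  have dvd_sub_one : (n : ℤ) ∣ r - 1 := Ideal.mem_span_singleton.1 hr
  have r_ne_zero : r ≠ 0 := by
    rintro rfl
    exact hn (Nat.dvd_one.1 (by simpa [Int.natCast_dvd] using dvd_sub_one))
  have finite : Finite A := Module.finite_of_fg_torsion A fun x =>
    ⟨⟨r, mem_nonZeroDivisors_of_ne_zero r_ne_zero⟩, hr_smul x Submodule.mem_top⟩
  refine ⟨finite, Nat.coprime_of_dvd fun p hp hp_card hpn => ?_⟩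
  have : Fact p.Prime := ⟨hp⟩
  obtain ⟨x, hx⟩ := exists_prime_addOrderOf_dvd_card' p hp_card
  have dvd_r : (p : ℤ) ∣ r :=
    hx ▸ addOrderOf_dvd_iff_zsmul_eq_zero.2 (hr_smul x Submodule.mem_top)
  refine (Nat.prime_iff_prime_int.1 hp).not_dvd_one ?_
  exact (dvd_sub_right dvd_r).1 ((Int.natCast_dvd_natCast.2 hpn).trans dvd_sub_one)

theorem surjective_nsmul_map_mkQ_iff {R M : Type*} [Ring R] [AddCommGroup M] [Module R M]
    {Z B : Submodule R M} {n : ℕ} :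
    Function.Surjective (n • · : Z.map B.mkQ → Z.map B.mkQ) ↔
      ∀ z ∈ Z, ∃ v ∈ Z, z - n • v ∈ B := by
  have mk_eq (z v : M) : n • B.mkQ v = B.mkQ z ↔ z - n • v ∈ B := by
    rw [← map_nsmul, eq_comm]
    exact Submodule.Quotient.eq B
  simp only [Function.Surjective, Subtype.forall, Subtype.exists, Subtype.ext_iff,
    Submodule.coe_smul_of_tower, Submodule.mem_map, forall_exists_index, and_imp,
    forall_apply_eq_imp_iff₂, exists_prop, exists_exists_and_eq_and, mk_eq]

section ModTwo

variable {n : ℕ}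

theorem exists_eq_two_nsmul {φ : Cochain X n} (h : ∀ σ, (2 : ℤ) ∣ φ (Chain.of σ)) :
    ∃ ψ : Cochain X n, φ = 2 • ψ := by
  choose g hg using h
  exact ⟨Finsupp.linearCombination ℤ g, hom_ext_single fun σ => by simp [hg]⟩

theorem two_dvd_units_sub (u v : ℤˣ) : (2 : ℤ) ∣ u - v := by
  rcases Int.units_eq_one_or u with rfl | rfl <;> rcases Int.units_eq_one_or v with rfl | rfl <;>
    norm_num

theorem exists_coboundary_sub_eq (w w' : Twist X) (φ : Cochain X n) :
    ∃ ψ : Cochain X (n + 1), coboundary w n φ - coboundary w' n φ = 2 • ψ := by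
  refine exists_eq_two_nsmul fun σ => ?_
  simp only [LinearMap.sub_apply, coboundary_apply, bd_of, map_sum, map_smul,
    ← Finset.sum_sub_distrib, smul_eq_mul, ← sub_mul, ← mul_sub]
  exact Finset.dvd_sum fun i _ => ((two_dvd_units_sub _ _).mul_left _).mul_right _

theorem exists_sub_mem_coboundaries {w : Twist X} {S : ∀ n, Set C(Simplex n, X)}
    {φ : Cochain X n} (hφ : φ ∈ coboundaries w S n) (w' : Twist X) :
    ∃ ψ : Cochain X n, φ - 2 • ψ ∈ coboundaries w' S n := by
  rcases n with _ | n
  · exact ⟨0, by rwa [smul_zero, sub_zero]⟩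
  obtain ⟨_, ⟨χ, rfl⟩, ζ, hζ, rfl⟩ := Submodule.mem_sup.1 hφ
  obtain ⟨ψ, hψ⟩ := exists_coboundary_sub_eq w w' χ
  refine ⟨ψ, ?_⟩
  rw [← hψ, show coboundary w n χ + ζ - (coboundary w n χ - coboundary w' n χ) =
    coboundary w' n χ + ζ by abel]
  exact Submodule.add_mem_sup ⟨χ, rfl⟩ hζ

theorem two_nsmul_mem_cocycles_iff {w : Twist X} {S : ∀ n, Set C(Simplex n, X)}
    {φ : Cochain X n} : 2 • φ ∈ cocycles w S n ↔ φ ∈ cocycles w S n := by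
  simp [mem_cocycles_iff]

theorem dualAnnihilator_le_cocycles (w : Twist X) (A : Set X) (n : ℕ) :
    (supp (inSet A n)).dualAnnihilator ≤ cocycles w (inSet A) n := fun φ hφ =>
  mem_cocycles_iff.2 fun _ hσ => (Submodule.mem_dualAnnihilator φ).1 hφ _
    (bd_mem_supp w (Finsupp.single_mem_supported ℤ 1 hσ))

theorem coboundaries_le_cocycles (w : Twist X) (A : Set X) (n : ℕ) :
    coboundaries w (inSet A) n ≤ cocycles w (inSet A) n := by
  rcases n with _ | n
  · exact dualAnnihilator_le_cocycles w A 0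
  · refine sup_le ?_ (dualAnnihilator_le_cocycles w A (n + 1))
    rintro _ ⟨ψ, rfl⟩
    exact coboundary_mem_cocycles ψ

/-- The difference `δ_w z - δ_w' z` is `2 y` for a cocycle `y`, and if `y = δ_w x` then `z - 2 x` is
a cocycle for `w`. -/
theorem exists_sub_two_nsmul_mem_cocycles {w w' : Twist X} {A : Set X}
    (hsucc : cocycles w (inSet A) (n + 1) ≤ coboundaries w (inSet A) (n + 1))
    {z : Cochain X n} (hz : z ∈ cocycles w' (inSet A) n) :
    ∃ x, z - 2 • x ∈ cocycles w (inSet A) n := by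
  obtain ⟨y, hy⟩ := exists_coboundary_sub_eq w w' z
  have hy_mem : y ∈ cocycles w (inSet A) (n + 1) := two_nsmul_mem_cocycles_iff.1 <|
    hy ▸ sub_mem (coboundary_mem_cocycles z) (dualAnnihilator_le_cocycles w A (n + 1) hz)
  obtain ⟨_, ⟨x, rfl⟩, ζ, hζ, rfl⟩ := Submodule.mem_sup.1 (hsucc hy_mem)
  refine ⟨x, ?_⟩
  have hx : coboundary w n (z - 2 • x) = coboundary w' n z + 2 • ζ := by
    rw [map_sub, map_nsmul, sub_eq_iff_eq_add.1 hy]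
    simp only [smul_add]
    abel
  rw [cocycles, Submodule.mem_comap, hx]
  exact add_mem hz (nsmul_mem hζ 2)

theorem surjective_two_nsmul_cohomology {w : Twist X} {A : Set X}
    (hsucc : cocycles w (inSet A) (n + 1) ≤ coboundaries w (inSet A) (n + 1))
    (h : Function.Surjective (2 • · : cohomology w (inSet A) n → cohomology w (inSet A) n))
    (w' : Twist X) :
    Function.Surjective (2 • · : cohomology w' (inSet A) n → cohomology w' (inSet A) n) := by
  refine surjective_nsmul_map_mkQ_iff.2 fun z hz => ?_
  obtain ⟨x, hx⟩ := exists_sub_two_nsmul_mem_cocycles hsucc hz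
  obtain ⟨v, -, hv⟩ := surjective_nsmul_map_mkQ_iff.1 h _ hx
  obtain ⟨t, ht⟩ := exists_sub_mem_coboundaries hv w'
  have hsub : z - 2 • (x + v + t) ∈ coboundaries w' (inSet A) n := by
    convert ht using 1
    simp only [smul_add]
    abel
  refine ⟨x + v + t, two_nsmul_mem_cocycles_iff.1 ?_, hsub⟩
  rw [← sub_sub_cancel z (2 • (x + v + t))]
  exact sub_mem hz (coboundaries_le_cocycles w' A n hsub)

end ModTwo

end TwistedSingular

end

open TwistedSingular in
theorem theorem2p1_general {K : Type*} [TopologicalSpace K] [T2Space K] [ConnectedSpace K]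
    [CWComplex (Set.univ : Set K)] [RelCWComplex.Finite (Set.univ : Set K)] {d : ℕ}
    (hdim : ∀ n : ℕ, d < n → IsEmpty (RelCWComplex.cell (Set.univ : Set K) n)) {x₀ : K}
    {β : FundamentalGroup K x₀ →* ℤˣ} (hβ : Odd (Nat.card (LocalCoeff.Cohomology β d)))
    (α : FundamentalGroup K x₀ →* ℤˣ) :
    Finite (LocalCoeff.Cohomology α d) ∧ Odd (Nat.card (LocalCoeff.Cohomology α d)) := by
  have := pathConnectedSpace_of_finite_complex (X := K)
  let γ (x : K) : Path.Homotopic.Quotient x₀ x := .mk (PathConnectedSpace.somePath x₀ x)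
  have bound (w : Twist K) : CohomologyBound w Set.univ (d + 1) := .of_finite_complex hdim
  let eα := cohomologyEquiv α γ d
  let eβ := cohomologyEquiv β γ d
  rw [← Nat.coprime_two_right, Nat.card_congr eβ.toEquiv] at hβ
  rw [← Nat.coprime_two_right, Nat.card_congr eα.toEquiv, eα.toEquiv.finite_iff]
  have := Module.Finite.iff_fg.2 ((bound (.ofHom α γ)).fg d)
  exact finite_and_coprime_card_of_surjective_nsmul (by decide) <|
    surjective_two_nsmul_cohomology ((bound _).vanish (d + 1) le_rfl)
      hβ.nsmul_right_bijective.surjective (.ofHom α γ)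

theorem theorem2p1 {K : Type*} [TopologicalSpace K] [T2Space K] [ConnectedSpace K]
    [CWComplex (Set.univ : Set K)] [RelCWComplex.Finite (Set.univ : Set K)]
    (hdim : ∀ n : ℕ, 2 < n → IsEmpty (RelCWComplex.cell (Set.univ : Set K) n)) (x₀ : K)
    (h : ∃ β : FundamentalGroup K x₀ →* ℤˣ,
      Finite (LocalCoeff.Cohomology β 2) ∧ Odd (Nat.card (LocalCoeff.Cohomology β 2))) :
    ∀ α : FundamentalGroup K x₀ →* ℤˣ,
      Finite (LocalCoeff.Cohomology α 2) ∧ Odd (Nat.card (LocalCoeff.Cohomology α 2)) :=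
  h.elim fun _ hβ => theorem2p1_general hdim hβ.2
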